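/- Let $d\ge 1$, let $\mathcal X\subseteq\mathbb R^d$ be measurable, and let $(X_i,Y_i,Z_i)$, $i=1,\dots,n$, be i.i.d. $\mathcal X^3$-valued triples with a joint Lebesgue density $p(x,y,z)$. Let $\mathcal I_m$ be a set of $m$ indices drawn uniformly without replacement from $\{1,\dots,n\}$, independently of the data, and for $\zeta\in\mathbb R^d$ let $\mathcal A^m(\zeta)$ be the set of indices of the $k$ nearest neighbours of $\zeta$ (in Euclidean distance, ties broken arbitrarily) among the $Z_j$ with $j\notin\mathcal I_m$. Here $k=k(n)$ and $m=m(n)$ satisfy $k(n)=\Theta(n^{1/2+\epsilon_0})$ for some $\epsilon_0>0$, $n-k(n)\ge m(n)\ge k(n)$ for all large $n$, and $k(n)/(n-m(n))\to 0$. Let $g:\mathcal X^3\to\mathbb R$ be measurable with $g^{\min}\le g\le g^{\max}$, where $g^{\min},g^{\max}$ are finite, and put $c=g^{\max}-g^{\min}$, $M=\max\{|g^{\min}|,|g^{\max}|\}$, and $$\hat g=\frac1m\sum_{i\in\mathcal I_m}\frac1k\sum_{j\in\mathcal A^m(Z_i)}g(X_j,Y_i,Z_i).$$ Then for every $\epsilon>0$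 there is an integer $n_0$ such that for all $n>n_0$ $$\mathbb P\Big(\big|\hat g-\mathbb E_{p(x|z)p(y,z)}[g(X,Y,Z)]\big|\ge 3\epsilon\Big)\le\delta_1(\epsilon,c,M),$$ where $$\delta_1(\epsilon,c,M)=2\exp\Big(\frac{-2\epsilon^2k^2}{nc^2}\Big)+2\exp\Big(\frac{-2\epsilon^2k^2}{(n-m)c^2}\Big)+\exp\Big(\frac{-(n-m)\epsilon^2}{8M^2\gamma_d^2}\Big),$$ and $\gamma_d$ is the minimal number of cones centred at the origin, of angle $\pi/6$ (a cone of angle $\theta$ and axis $u\ne0$ consists of the origin and all points whose angle with $u$ is at most $\theta$), that cover $\mathbb R^d$. The integer $n_0$ depends only on $p$, $g$, $g^{\min}$, $g^{\max}$, the sequences $k,m$, and $\epsilon$. (If $c=0$ or $M=0$, the exponentials with $c$ or $M$ in a denominator are read as $1$ and the bound is trivial.) -/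

import Mathlib

open MeasureTheory ProbabilityTheory Filter Topology
open scoped ENNReal

namespace IsolatedKNN

/-- Euclidean space `ℝ^d`. -/
abbrev Vec (d : ℕ) : Type := EuclideanSpace ℝ (Fin d)

/-- `A` is a set of indices of `k` nearest neighbours of `ζ` (in Euclidean distance) among the
points `z j`, `j ∈ J`: the first `k` indices of an enumeration `π` of `J` by nondecreasing distance
to `ζ`. The set is unique unless there are ties. -/
def IsKNearest {d n : ℕ} (z : Fin n → Vec d) (J : Finset (Fin n)) (k : ℕ) (ζ : Vec d)
    (A : Finset (Fin n)) : Prop :=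
  k ≤ J.card ∧ ∃ π : Fin J.card ≃ {j // j ∈ J},
    (∀ r s : Fin J.card, r ≤ s → dist (z (π r)) ζ ≤ dist (z (π s)) ζ) ∧
    ∀ j : Fin n, j ∈ A ↔ ∃ r : Fin J.card, (r : ℕ) < k ∧ (π r : Fin n) = j

/-- The isolated `k`-NN empirical average
`(1/m) ∑_{i ∈ I} (1/k) ∑_{j ∈ A (z i)} g (x j) (y i) (z i)`. -/
noncomputable def empAverage {d n : ℕ} (g : Vec d → Vec d → Vec d → ℝ) (m k : ℕ)
    (I : Finset (Fin n)) (A : Vec d → Finset (Fin n)) (x y z : Fin n → Vec d) : ℝ :=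
  (1 / (m : ℝ)) * ∑ i ∈ I, (1 / (k : ℝ)) * ∑ j ∈ A (z i), g (x j) (y i) (z i)

section Densities

variable {d : ℕ} (p : Vec d × Vec d × Vec d → ℝ≥0∞)

/-- The marginal density `p(x,z)` of a joint density `p(x,y,z)`. -/
noncomputable def margXZ (x z : Vec d) : ℝ≥0∞ := ∫⁻ y, p (x, y, z)

/-- The marginal density `p(y,z)`. -/
noncomputable def margYZ (y z : Vec d) : ℝ≥0∞ := ∫⁻ x, p (x, y, z)

/-- The marginal density `p(z)`. -/
noncomputable def margZ (z : Vec d) : ℝ≥0∞ := ∫⁻ x, ∫⁻ y, p (x, y, z)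

/-- The conditional density `p(x|z) = p(x,z) / p(z)`. -/
noncomputable def condXZ (x z : Vec d) : ℝ≥0∞ := margXZ p x z / margZ p z

/-- The probability measure with density `p(x|z) p(y,z)`. -/
noncomputable def prodMeasure : Measure (Vec d × Vec d × Vec d) :=
  volume.withDensity fun w => condXZ p w.1 w.2.2 * margYZ p w.2.1 w.2.2

/-- The expectation of `g(X,Y,Z)` under the density `p(x|z) p(y,z)`. -/
noncomputable def prodExpectation (g : Vec d → Vec d → Vec d → ℝ) : ℝ :=
  ∫ w, g w.1 w.2.1 w.2.2 ∂(prodMeasure p)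

end Densities

/-- The closed cone with apex at the origin, axis `u` and angle `θ`
(all points whose angle with `u` is at most `θ`, and the origin). -/
def cone {d : ℕ} (u : Vec d) (θ : ℝ) : Set (Vec d) :=
  {v | v = 0 ∨ InnerProductGeometry.angle u v ≤ θ}

/-- The minimal number of cones of angle `π/6`, centred at the origin, that cover `ℝ^d`. -/
noncomputable def coneCover (d : ℕ) : ℕ :=
  sInf {N : ℕ | ∃ S : Finset (Vec d), S.card = N ∧ (∀ u ∈ S, u ≠ 0) ∧
    ∀ v : Vec d, ∃ u ∈ S, v ∈ cone u (Real.pi / 6)}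

/-- The bound `δ₁(ε, c, M)`, with its dependence on `n`, `m`, `k` and `γ = γ_d` explicit. -/
noncomputable def delta1 (n m k γ : ℕ) (ε c M : ℝ) : ℝ :=
  2 * Real.exp (-2 * ε ^ 2 * (k : ℝ) ^ 2 / ((n : ℝ) * c ^ 2))
    + 2 * Real.exp (-2 * ε ^ 2 * (k : ℝ) ^ 2 / (((n : ℝ) - (m : ℝ)) * c ^ 2))
    + Real.exp (-(((n : ℝ) - (m : ℝ)) * ε ^ 2) / (8 * M ^ 2 * (γ : ℝ) ^ 2))

/-- The sampling model: `(X i, Y i, Z i)`, `i < n`, are i.i.d. with density `p`, and `I` is a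
set of `m` indices drawn uniformly without replacement, independently of the data. -/
structure IsSample {Ω : Type*} [MeasurableSpace Ω] (P : Measure Ω) {d n : ℕ}
    (p : Vec d × Vec d × Vec d → ℝ≥0∞) (m : ℕ) (X Y Z : Fin n → Ω → Vec d)
    (I : Ω → Finset (Fin n)) : Prop where
  measurable_X : ∀ i, Measurable (X i)
  measurable_Y : ∀ i, Measurable (Y i)
  measurable_Z : ∀ i, Measurable (Z i)
  law : ∀ i, P.map (fun ω => (X i ω, Y i ω, Z i ω)) = volume.withDensity p
  indep : iIndepFun (fun i ω => (X i ω, Y i ω, Z i ω)) P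
  card_I : ∀ ω, (I ω).card = m
  measurableSet_I : ∀ s : Finset (Fin n), MeasurableSet {ω | I ω = s}
  uniform_I : ∀ s : Finset (Fin n), s.card = m → P {ω | I ω = s} = ((n.choose m : ℕ) : ℝ≥0∞)⁻¹
  indep_I : @IndepFun Ω (Finset (Fin n)) (Fin n → Vec d × Vec d × Vec d) _ ⊤ _ I
    (fun ω i => (X i ω, Y i ω, Z i ω)) P

end IsolatedKNN

open IsolatedKNN

/-! The k nearest neighbours are compared with a deterministic ball. Let `μ` be the law of Z, `N = n
- m` and `t = k/N`. As `μ` is absolutely continuous, every centre ζ has a closed ball of `μ`-measure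
exactly `t`, and this ball contains on average `k` of the `N` non-isolated points. The neighbour set
and the set of sample points in the ball are nested, so their sums of g differ by at most M times
the deviation of the count from `k` (`IsKNearest.abs_sum_sub_sum_le`).

Conditionally on the i-th triple, the ball sums are sums of `N` independent bounded terms of second
moment at most `t * M ^ 2`, hence of total variance O(k). A Bernstein-type Chernoff bound makes a
deviation of order `k` exponentially unlikely in `k`; a union bound over the isolated indices costs
a factor of at most `n` (`measure_deviationSet_le`).

The normalized mean of a ball sum is the `μ`-average over the ball of z ↦ ∫ p(x|z) g(x,y',z') dx.
The balls shrink as `t → 0`, so Lebesgue differentiation (Besicovitch, valid for any `μ`) and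
dominated convergence give the target expectation (`tendsto_integral_localMean`).

The failure probability is thus at most `(4n+2) exp(-a k)` for some `a > 0`. Since `k/n → 0` and `k`
is at least of order √n, this is eventually below the first term of δ₁ alone, so no cone covering
argument is needed. -/

namespace IsolatedKNN

/-! ### Exponential moment bounds for sums of independent variables -/

section Chernoff

variable {α : Type*} [MeasurableSpace α] (ν : Measure α) [IsProbabilityMeasure ν]

/-- Integrate e^u ≤ 1 + u + u² for |u| ≤ 1, then use 1 + x ≤ e^x. Keeping the second moment, rather
than the range, is what later yields an exponent linear in `k`. -/
lemma integral_exp_centered_le {V : α → ℝ} (hV : Measurable V) {M : ℝ} (hM : ∀ a, |V a| ≤ M)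
    {v : ℝ} (hv : ∫ a, V a ^ 2 ∂ν ≤ v) {l : ℝ} (hl : 0 ≤ l) (hlM : l * M ≤ 1) :
    ∫ a, Real.exp (l * (V a - ∫ b, V b ∂ν)) ∂ν ≤ Real.exp (l ^ 2 * v) := by
  have hVi : Integrable V ν := .of_bound hV.aestronglyMeasurable M (.of_forall hM)
  have hV2 : Integrable (fun a => V a ^ 2) ν := by
    refine .of_bound (hV.pow_const 2).aestronglyMeasurable (M ^ 2) (.of_forall fun a => ?_)
    rw [Real.norm_eq_abs, abs_pow]
    exact pow_le_pow_left₀ (abs_nonneg _) (hM a) 2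
  set E := ∫ b, V b ∂ν with hE
  have hpt (a : α) : Real.exp (l * V a) ≤ 1 + l * V a + l ^ 2 * V a ^ 2 := by
    have h1 : |l * V a| ≤ 1 := by
      rw [abs_mul, abs_of_nonneg hl]
      exact (mul_le_mul_of_nonneg_left (hM a) hl).trans hlM
    have := (abs_le.1 (Real.abs_exp_sub_one_sub_id_le h1)).2
    nlinarith
  have hmono : ∫ a, Real.exp (l * V a) ∂ν ≤ ∫ a, (1 + l * V a + l ^ 2 * V a ^ 2) ∂ν := by
    refine integral_mono_of_nonneg (.of_forall fun a => (Real.exp_pos _).le) ?_ (.of_forall hpt)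
    exact ((integrable_const 1).add (hVi.const_mul l)).add (hV2.const_mul _)
  have hcomp : ∫ a, (1 + l * V a + l ^ 2 * V a ^ 2) ∂ν = 1 + l * E + l ^ 2 * ∫ a, V a ^ 2 ∂ν := by
    rw [integral_add (f := fun a => 1 + l * V a) ((integrable_const 1).add (hVi.const_mul l))
      (hV2.const_mul _), integral_add (integrable_const 1) (hVi.const_mul l), integral_const_mul,
      integral_const_mul]
    simp [hE]
  have hbound : ∫ a, Real.exp (l * V a) ∂ν ≤ Real.exp (l * E + l ^ 2 * v) := by
    have := Real.add_one_le_exp (l * E + l ^ 2 * v)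
    have := mul_le_mul_of_nonneg_left hv (sq_nonneg l)
    linarith
  calc ∫ a, Real.exp (l * (V a - E)) ∂ν = Real.exp (-(l * E)) * ∫ a, Real.exp (l * V a) ∂ν := by
        rw [← integral_const_mul]
        congr 1 with a
        rw [← Real.exp_add]
        ring_nf
    _ ≤ Real.exp (-(l * E)) * Real.exp (l * E + l ^ 2 * v) := by gcongr
    _ = Real.exp (l ^ 2 * v) := by rw [← Real.exp_add]; ring_nf

/-- A Chernoff bound for sums of i.i.d. bounded variables with small second moment. -/
lemma measure_pi_sum_centered_ge_le {κ : Type*} [Fintype κ] {V : α → ℝ} (hV : Measurable V) {M : ℝ}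
    (hM : ∀ a, |V a| ≤ M) {v : ℝ} (hv : ∫ a, V a ^ 2 ∂ν ≤ v) {l : ℝ} (hl : 0 ≤ l)
    (hlM : l * M ≤ 1) (a : ℝ) :
    (Measure.pi fun _ : κ => ν) {w | a ≤ ∑ j, (V (w j) - ∫ b, V b ∂ν)} ≤
      ENNReal.ofReal (Real.exp (-l * a + Fintype.card κ * (l ^ 2 * v))) := by
  set E := ∫ b, V b ∂ν
  have hexp (w : κ → α) : Real.exp (l * ∑ j, (V (w j) - E)) =
      ∏ j, Real.exp (l * (V (w j) - E)) := by rw [Finset.mul_sum, Real.exp_sum]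
  have hf : Integrable (fun b => Real.exp (l * (V b - E))) ν := by
    refine .of_bound (by fun_prop) (Real.exp (l * (M - E))) (.of_forall fun b => ?_)
    rw [Real.norm_eq_abs, abs_of_pos (Real.exp_pos _)]
    have := (abs_le.1 (hM b)).2
    gcongr
  have hint : Integrable (fun w : κ → α => Real.exp (l * ∑ j, (V (w j) - E)))
      (Measure.pi fun _ : κ => ν) := by
    simp_rw [hexp]
    exact Integrable.fintype_prod (f := fun _ b => Real.exp (l * (V b - E))) fun _ => hf
  have h1 := measure_ge_le_exp_mul_mgf (μ := Measure.pi fun _ : κ => ν) a hl hint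
  have h2 : mgf (fun w : κ → α => ∑ j, (V (w j) - E)) (Measure.pi fun _ : κ => ν) l ≤
      Real.exp (Fintype.card κ * (l ^ 2 * v)) := by
    rw [mgf]
    simp_rw [hexp]
    rw [integral_fintype_prod_eq_pow (fun b => Real.exp (l * (V b - E))), Real.exp_nat_mul]
    exact pow_le_pow_left₀ (integral_nonneg fun _ => (Real.exp_pos _).le)
      (integral_exp_centered_le ν hV hM hv hl hlM) _
  rw [← ENNReal.ofReal_toReal (measure_ne_top (Measure.pi fun _ : κ => ν) _)]
  refine ENNReal.ofReal_le_ofReal (h1.trans ?_)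
  rw [Real.exp_add]
  gcongr

/-- The Chernoff bound for the variables `h (w j) (w i)`, `j ∈ J`, conditionally on `w i`,
`i ∉ J`. -/
lemma measure_pi_sum_centered_ge_le_of_notMem {ι : Type*} [Fintype ι] [DecidableEq ι]
    {h : α → α → ℝ} (hh : Measurable fun q : α × α => h q.1 q.2) {M : ℝ}
    (hM : ∀ a b, |h a b| ≤ M) {v : ℝ} (hv : ∀ b, ∫ a, h a b ^ 2 ∂ν ≤ v) {l : ℝ} (hl : 0 ≤ l)
    (hlM : l * M ≤ 1) (J : Finset ι) {i : ι} (hi : i ∉ J) (a : ℝ) :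
    (Measure.pi fun _ : ι => ν) {w | a ≤ ∑ j ∈ J, (h (w j) (w i) - ∫ b, h b (w i) ∂ν)} ≤
      ENNReal.ofReal (Real.exp (-l * a + J.card * (l ^ 2 * v))) := by
  have hE : Measurable fun b => ∫ a, h a b ∂ν :=
    (hh.stronglyMeasurable.integral_prod_left' (μ := ν)).measurable
  -- Split the product space into the coordinates in `J` and the others. With the latter frozen, `w
  -- i` is a constant and the i.i.d. bound applies; its right-hand side does not depend on the
  -- frozen values.
  have hp := measurePreserving_piEquivPiSubtypeProd (fun _ : ι => ν) (· ∈ J)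
  set T : Set ((({j // j ∈ J} → α)) × ({j // j ∉ J} → α)) :=
    {q | a ≤ ∑ j, (h (q.1 j) (q.2 ⟨i, hi⟩) - ∫ b, h b (q.2 ⟨i, hi⟩) ∂ν)} with hT
  have hTm : MeasurableSet T := by
    refine measurableSet_le measurable_const (Finset.measurable_sum _ fun j _ => ?_)
    refine Measurable.sub (hh.comp (Measurable.prodMk ?_ ?_)) (hE.comp ?_) <;> fun_prop
  have hpre : {w : ι → α | a ≤ ∑ j ∈ J, (h (w j) (w i) - ∫ b, h b (w i) ∂ν)} =
      MeasurableEquiv.piEquivPiSubtypeProd (fun _ : ι => α) (· ∈ J) ⁻¹' T := by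
    ext w
    simp only [Set.mem_ofPred_eq, Set.mem_preimage, hT]
    rw [← Finset.sum_coe_sort J]
    rfl
  rw [hpre, hp.measure_preimage hTm.nullMeasurableSet, Measure.prod_apply_symm hTm]
  calc _ ≤ ∫⁻ _ : ({j // j ∉ J} → α), ENNReal.ofReal (Real.exp (-l * a + J.card * (l ^ 2 * v)))
        ∂(Measure.pi fun _ => ν) := by
        refine lintegral_mono fun y => ?_
        have := measure_pi_sum_centered_ge_le (κ := {j // j ∈ J}) ν
          (V := fun x => h x (y ⟨i, hi⟩)) (hh.comp (measurable_id.prodMk measurable_const))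
          (fun x => hM x _) (hv _) hl hlM a
        rw [Fintype.card_coe] at this
        convert this using 2
        · congr!
        · rfl
    _ = _ := by simp

end Chernoff

/-! ### Nearest neighbours versus points in a ball -/

section NearestNeighbours

variable {d n : ℕ} {z : Fin n → Vec d} {J : Finset (Fin n)} {k : ℕ} {ζ : Vec d}
  {A : Finset (Fin n)}

lemma IsKNearest.card_eq (h : IsKNearest z J k ζ A) : A.card = k := by
  obtain ⟨hk, π, -, hA⟩ := h
  have : A = (Finset.univ.filter fun r : Fin J.card => (r : ℕ) < k).map
      (π.toEmbedding.trans (Function.Embedding.subtype _)) := by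
    ext j
    simp [hA]
  rw [this, Finset.card_map, Fin.card_filter_val_lt, min_eq_right hk]

lemma IsKNearest.subset (h : IsKNearest z J k ζ A) : A ⊆ J := by
  obtain ⟨-, π, -, hA⟩ := h
  intro j hj
  obtain ⟨r, -, rfl⟩ := (hA j).1 hj
  exact (π r).2

/-- If some selected index lies farther than `ρ`, the monotone enumeration lists every point of the
ball before it; otherwise all selected points are in the ball. Ties play no role. -/
lemma IsKNearest.subset_or_subset (h : IsKNearest z J k ζ A) (ρ : ℝ) :
    A ⊆ J.filter (fun j => dist (z j) ζ ≤ ρ) ∨ J.filter (fun j => dist (z j) ζ ≤ ρ) ⊆ A := by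
  have hAJ := h.subset
  obtain ⟨-, π, hπ, hA⟩ := h
  by_cases hr : ∃ r : Fin J.card, (r : ℕ) < k ∧ ρ < dist (z (π r)) ζ
  · obtain ⟨r, hrk, hr⟩ := hr
    right
    intro j hj
    obtain ⟨hjJ, hjρ⟩ := Finset.mem_filter.1 hj
    obtain ⟨s, hs⟩ := π.surjective ⟨j, hjJ⟩
    have hsj : (π s : Fin n) = j := by rw [hs]
    refine (hA j).2 ⟨s, ?_, hsj⟩
    by_contra hsk
    have := hπ r s (Fin.le_def.2 (by omega))
    rw [hsj] at this
    linarith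
  · push Not at hr
    left
    intro j hj
    refine Finset.mem_filter.2 ⟨hAJ hj, ?_⟩
    obtain ⟨r, hrk, rfl⟩ := (hA j).1 hj
    exact hr r hrk

lemma abs_sum_sub_sum_le_of_subset {ι : Type*} [DecidableEq ι] {A B : Finset ι} (hAB : A ⊆ B)
    {v : ι → ℝ} {M : ℝ} (hv : ∀ j, |v j| ≤ M) :
    |∑ j ∈ B, v j - ∑ j ∈ A, v j| ≤ M * |(B.card : ℝ) - A.card| := by
  have hc : (B.card : ℝ) - A.card = (B \ A).card := by
    rw [Finset.card_sdiff_of_subset hAB, Nat.cast_sub (Finset.card_le_card hAB)]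
  rw [← Finset.sum_sdiff hAB, add_sub_cancel_right, hc, Nat.abs_cast, mul_comm, ← nsmul_eq_mul]
  exact (Finset.abs_sum_le_sum_abs _ _).trans (Finset.sum_le_card_nsmul _ _ _ fun j _ => hv j)

/-- The sum over the `k` nearest neighbours differs from the sum over the sample points in a ball
by at most a multiple of `|N - k|`, where `N` is the number of points in the ball. -/
lemma IsKNearest.abs_sum_sub_sum_le (h : IsKNearest z J k ζ A) (ρ : ℝ) {v : Fin n → ℝ} {M : ℝ}
    (hv : ∀ j, |v j| ≤ M) :
    |∑ j ∈ A, v j - ∑ j ∈ J.filter (fun j => dist (z j) ζ ≤ ρ), v j| ≤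
      M * |((J.filter (fun j => dist (z j) ζ ≤ ρ)).card : ℝ) - k| := by
  rcases h.subset_or_subset ρ with hs | hs
  · have := abs_sum_sub_sum_le_of_subset hs hv
    rwa [h.card_eq, abs_sub_comm] at this
  · have := abs_sum_sub_sum_le_of_subset hs hv
    rwa [h.card_eq, abs_sub_comm (k : ℝ)] at this

end NearestNeighbours

/-! ### Balls of prescribed measure -/

section Balls

variable {d : ℕ} (μ : Measure (Vec d))

/-- The ball around `z` of `μ`-measure `t`, as the sublevel set of the measure of balls. -/
def nearBall (t : ℝ) (z : Vec d) : Set (Vec d) :=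
  {z' | μ (Metric.closedBall z (dist z' z)) ≤ ENNReal.ofReal t}

variable [IsProbabilityMeasure μ]

/-- Describing the ball as a sublevel set avoids choosing a radius, so joint measurability in point
and centre reduces to measurability of the measures of sections. -/
lemma measurableSet_nearBall_prod (t : ℝ) :
    MeasurableSet {q : Vec d × Vec d | q.1 ∈ nearBall μ t q.2} := by
  have hs : MeasurableSet {r : (Vec d × Vec d) × Vec d | dist r.2 r.1.2 ≤ dist r.1.1 r.1.2} :=
    measurableSet_le (by fun_prop) (by fun_prop)
  have hF : Measurable fun q : Vec d × Vec d => μ (Metric.closedBall q.2 (dist q.1 q.2)) :=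
    measurable_measure_prodMk_left (ν := μ) hs
  exact hF measurableSet_Iic

lemma measurableSet_nearBall (t : ℝ) (z : Vec d) : MeasurableSet (nearBall μ t z) := by
  have hf : Measurable fun z' : Vec d => (z', z) := by fun_prop
  have := hf (measurableSet_nearBall_prod μ t)
  simpa only [Set.preimage_ofPred_eq, Set.ofPred_mem_eq] using this

/-- Spheres are Lebesgue-null in positive dimension, so the distance to `z` has a continuous
distribution function, which attains `t`. The largest radius attaining it turns the sublevel set
into a closed ball. -/
lemma exists_nearBall_eq_closedBall (hd : 0 < d) (hμ : μ ≪ volume) {t : ℝ} (ht0 : 0 < t)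
    (ht1 : t < 1) (z : Vec d) :
    ∃ ρ : ℝ, 0 < ρ ∧ nearBall μ t z = Metric.closedBall z ρ ∧
      μ (Metric.closedBall z ρ) = ENNReal.ofReal t := by
  have : Nonempty (Fin d) := ⟨⟨0, hd⟩⟩
  have hm : Measurable fun z' : Vec d => dist z' z := by fun_prop
  set D : Measure ℝ := μ.map fun z' => dist z' z with hD
  have : IsProbabilityMeasure D := Measure.isProbabilityMeasure_map hm.aemeasurable
  have hG (r : ℝ) : μ (Metric.closedBall z r) = ENNReal.ofReal (cdf D r) := by
    rw [ofReal_cdf, hD, Measure.map_apply hm measurableSet_Iic]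
    rfl
  have hcont : Continuous (cdf D) := by
    refine continuous_iff_continuousAt.2 fun r => ?_
    rw [(cdf D).mono.continuousAt_iff_leftLim_eq_rightLim, (cdf D).rightLim_eq]
    have h1 : (cdf D).measure {r} = 0 := by
      rw [measure_cdf, hD, Measure.map_apply hm (measurableSet_singleton r)]
      exact hμ (Measure.addHaar_sphere volume z r)
    rw [StieltjesFunction.measure_singleton, ENNReal.ofReal_eq_zero] at h1
    exact le_antisymm ((cdf D).mono.leftLim_le le_rfl) (by linarith)
  obtain ⟨r₀, hr₀⟩ : t ∈ Set.range (cdf D) := by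
    refine mem_range_of_exists_le_of_exists_ge hcont ?_ ?_
    · exact (((tendsto_cdf_atBot D).eventually (gt_mem_nhds ht0)).exists).imp fun _ => le_of_lt
    · exact (((tendsto_cdf_atTop D).eventually (lt_mem_nhds ht1)).exists).imp fun _ => le_of_lt
  set T : Set ℝ := {r | cdf D r ≤ t} with hT
  have hbdd : BddAbove T := by
    obtain ⟨b, hb⟩ := ((tendsto_cdf_atTop D).eventually (lt_mem_nhds ht1)).exists
    refine ⟨b, fun r hr => ?_⟩
    by_contra hbr
    exact absurd ((cdf D).mono (not_le.1 hbr).le) (not_le.2 (lt_of_le_of_lt hr hb))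
  have hmem : sSup T ∈ T :=
    (isClosed_le hcont continuous_const).csSup_mem ⟨r₀, hr₀.le⟩ hbdd
  have hval : cdf D (sSup T) = t :=
    le_antisymm hmem (hr₀ ▸ (cdf D).mono (le_csSup hbdd hr₀.le))
  refine ⟨sSup T, ?_, ?_, by rw [hG, hval]⟩
  · by_contra hρ
    have h1 : μ (Metric.closedBall z (sSup T)) ≤ μ (Metric.closedBall z 0) :=
      measure_mono (Metric.closedBall_subset_closedBall (not_lt.1 hρ))
    rw [hG, hval, Metric.closedBall_zero, hμ (measure_singleton z)] at h1
    exact absurd (ENNReal.ofReal_pos.2 ht0) (not_lt.2 h1)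
  · ext z'
    rw [nearBall, Set.mem_ofPred_eq, hG, ENNReal.ofReal_le_ofReal_iff ht0.le, Metric.mem_closedBall]
    exact ⟨fun h => le_csSup hbdd h, fun h => ((cdf D).mono h).trans hval.le⟩

lemma measure_nearBall (hd : 0 < d) (hμ : μ ≪ volume) {t : ℝ} (ht0 : 0 < t)
    (ht1 : t < 1) (z : Vec d) : μ (nearBall μ t z) = ENNReal.ofReal t := by
  obtain ⟨ρ, -, h, h'⟩ := exists_nearBall_eq_closedBall μ hd hμ ht0 ht1 z
  rw [h, h']

/-- At a point of the support of `μ` every closed ball of positive radius has positive mass, so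
balls of mass tending to 0 have radii tending to 0. -/
lemma ae_tendsto_nearBall_filterAt (hd : 0 < d) (hμ : μ ≪ volume) {t : ℕ → ℝ}
    (ht0 : ∀ᶠ n in atTop, 0 < t n) (ht : Tendsto t atTop (𝓝 0)) :
    ∀ᵐ z ∂μ, Tendsto (fun n => nearBall μ (t n) z) atTop
      ((Besicovitch.vitaliFamily μ).filterAt z) := by
  filter_upwards [Measure.support_mem_ae (μ := μ)] with z hz
  have hz' := (Measure.mem_support_iff_forall z).1 hz
  have ht1 : ∀ᶠ n in atTop, t n < 1 := ht.eventually (gt_mem_nhds one_pos)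
  have hex : ∀ n, ∃ ρ : ℝ, 0 < t n → t n < 1 → 0 < ρ ∧ nearBall μ (t n) z = Metric.closedBall z ρ ∧
      μ (Metric.closedBall z ρ) = ENNReal.ofReal (t n) := by
    intro n
    by_cases h0 : 0 < t n
    · by_cases h1 : t n < 1
      · exact (exists_nearBall_eq_closedBall μ hd hμ h0 h1 z).imp fun _ h _ _ => h
      · exact ⟨0, fun _ h => absurd h h1⟩
    · exact ⟨0, fun h => absurd h h0⟩
  choose ρ hρ using hex
  have hρ0 : Tendsto ρ atTop (𝓝[>] 0) := by
    rw [tendsto_nhdsWithin_iff]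
    refine ⟨?_, ?_⟩
    · rw [Metric.tendsto_nhds]
      intro δ hδ
      have hpos : 0 < μ (Metric.closedBall z (δ / 2)) :=
        hz' _ (Metric.closedBall_mem_nhds z (half_pos hδ))
      have hlim : Tendsto (fun n => ENNReal.ofReal (t n)) atTop (𝓝 0) := by
        simpa using ENNReal.tendsto_ofReal ht
      filter_upwards [ht0, ht1, hlim.eventually (gt_mem_nhds hpos)] with n h0 h1 h2
      obtain ⟨h3, -, h4⟩ := hρ n h0 h1
      rw [Real.dist_eq, sub_zero, abs_of_pos h3]
      by_contra h5
      have : μ (Metric.closedBall z (δ / 2)) ≤ μ (Metric.closedBall z (ρ n)) :=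
        measure_mono (Metric.closedBall_subset_closedBall (by linarith))
      rw [h4] at this
      exact absurd h2 (not_lt.2 this)
    · filter_upwards [ht0, ht1] with n h0 h1 using (hρ n h0 h1).1
  refine ((Besicovitch.tendsto_filterAt μ z).comp hρ0).congr' ?_
  filter_upwards [ht0, ht1] with n h0 h1 using (hρ n h0 h1).2.1.symm

end Balls

/-! ### Lebesgue points in total variation -/

section LebesguePoints

variable {d : ℕ} {μ : Measure (Vec d)} [IsProbabilityMeasure μ] {q : Vec d → Vec d → ℝ}

lemma abs_integral_mul_sub_integral_mul_le {q₁ q₂ r H : Vec d → ℝ} (h₁ : Integrable q₁)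
    (h₂ : Integrable q₂) (hr : Integrable r) (hH : Measurable H) {M : ℝ} (hM : ∀ x, |H x| ≤ M) :
    |(∫ x, q₁ x * H x) - ∫ x, q₂ x * H x| ≤
      M * ((∫ x, |q₁ x - r x|) + ∫ x, |q₂ x - r x|) := by
  have hb : ∀ᵐ x : Vec d, ‖H x‖ ≤ M := .of_forall hM
  have key {s : Vec d → ℝ} (hs : Integrable s) :
      |(∫ x, s x * H x) - ∫ x, r x * H x| ≤ M * ∫ x, |s x - r x| := by
    rw [← integral_sub (hs.mul_bdd hH.aestronglyMeasurable hb)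
      (hr.mul_bdd hH.aestronglyMeasurable hb), ← integral_const_mul]
    rw [← Real.norm_eq_abs]
    refine norm_integral_le_of_norm_le ((hs.sub hr).abs.const_mul M) (.of_forall fun x => ?_)
    rw [← sub_mul, Real.norm_eq_abs, abs_mul, mul_comm]
    exact mul_le_mul_of_nonneg_right (hM x) (abs_nonneg _)
  have := abs_sub_le (∫ x, q₁ x * H x) (∫ x, r x * H x) (∫ x, q₂ x * H x)
  rw [abs_sub_comm (∫ x, r x * H x)] at this
  linarith [key h₁, key h₂]

/-- Almost every `z` is a Lebesgue point, in total variation, of a measurable family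
`z ↦ q · z` of integrable functions. -/
lemma ae_eventually_abs_average_integral_sub_le
    (hq : Measurable fun w : Vec d × Vec d => q w.1 w.2)
    (hqi : ∀ᵐ z ∂μ, Integrable (fun x => q x z)) {C : ℝ} (hqC : ∀ᵐ z ∂μ, ∫ x, |q x z| ≤ C) :
    ∀ᵐ z ∂μ, ∀ η > 0, ∀ᶠ a in (Besicovitch.vitaliFamily μ).filterAt z,
      ∀ (M : ℝ) (H : Vec d → ℝ), Measurable H → (∀ x, |H x| ≤ M) →
        |(⨍ z' in a, (∫ x, q x z' * H x) ∂μ) - ∫ x, q x z * H x| ≤ M * η := by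
  have : Fact ((1 : ℝ≥0∞) ≠ ∞) := ⟨ENNReal.one_ne_top⟩
  -- Differentiating only the countably many functions `D l`, the L¹ distances to a dense sequence,
  -- gives one null set valid for all `H`. This is essential, since `H` will be g(·,y,z) and depend
  -- on the point itself.
  let r : ℕ → Lp ℝ 1 (volume : Measure (Vec d)) := TopologicalSpace.denseSeq _
  have hri (l : ℕ) : Integrable (r l) := L1.integrable_coeFn (r l)
  let D : ℕ → Vec d → ℝ := fun l z => ∫ x, |q x z - r l x|
  have hDm (l : ℕ) : Measurable (D l) := by
    have h : Measurable fun w : Vec d × Vec d => |q w.1 w.2 - r l w.1| :=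
      (hq.sub ((Lp.stronglyMeasurable (r l)).measurable.comp measurable_fst)).abs
    exact h.stronglyMeasurable.integral_prod_left'.measurable
  have hDi (l : ℕ) : Integrable (D l) μ := by
    refine .of_bound (hDm l).aestronglyMeasurable (C + ∫ x, |r l x|) ?_
    filter_upwards [hqi, hqC] with z hz hzC
    rw [Real.norm_eq_abs, abs_of_nonneg (integral_nonneg fun x => abs_nonneg _)]
    refine (integral_mono (hz.sub (hri l)).abs (hz.abs.add (hri l).abs)
      fun x => abs_sub _ _).trans ?_
    rw [integral_add' hz.abs (hri l).abs]
    linarith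
  have hav : ∀ᵐ z ∂μ, ∀ l, Tendsto (fun a => ⨍ y in a, D l y ∂μ)
      ((Besicovitch.vitaliFamily μ).filterAt z) (𝓝 (D l z)) :=
    ae_all_iff.2 fun l => (Besicovitch.vitaliFamily μ).ae_tendsto_average
      (hDi l).locallyIntegrable
  filter_upwards [hav, hqi, (Besicovitch.vitaliFamily μ).ae_eventually_measure_pos]
    with z hz hzi hpos η hη
  -- Both `D l z` and, for small sets, its average are below `η / 3`; the error is at most `M` times
  -- their sum.
  obtain ⟨l, hl⟩ : ∃ l, D l z < η / 3 := by
    obtain ⟨f, ⟨l, rfl⟩, hf⟩ := Metric.mem_closure_iff.1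
      (TopologicalSpace.denseRange_denseSeq (Lp ℝ 1 (volume : Measure (Vec d)))
        (hzi.toL1 (fun x => q x z))) (η / 3) (by positivity)
    refine ⟨l, lt_of_eq_of_lt ?_ hf⟩
    rw [L1.dist_eq_integral_dist]
    refine integral_congr_ae ?_
    filter_upwards [hzi.coeFn_toL1] with x hx
    rw [hx, Real.dist_eq]
  filter_upwards [hpos, (hz l).eventually (gt_mem_nhds hl)] with a ha hlt M H hH hM
  have hM0 : 0 ≤ M := (abs_nonneg _).trans (hM 0)
  have hane : μ a ≠ 0 := ha.ne'
  set Pa : Measure (Vec d) := (μ a)⁻¹ • μ.restrict a with hPa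
  have hac : Pa ≪ μ :=
    Measure.smul_absolutelyContinuous.trans Measure.restrict_le_self.absolutelyContinuous
  have hPap : IsProbabilityMeasure Pa := ⟨by
    rw [hPa, Measure.smul_apply, Measure.restrict_apply_univ, smul_eq_mul,
      ENNReal.inv_mul_cancel hane (measure_ne_top μ a)]⟩
  rw [setAverage_eq', ← hPa] at hlt ⊢
  have hDP : Integrable (D l) Pa :=
    (hDi l).restrict.smul_measure (ENNReal.inv_ne_top.2 hane)
  have hu : Measurable fun z' => ∫ x, q x z' * H x := by
    have h : Measurable fun w : Vec d × Vec d => q w.1 w.2 * H w.1 :=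
      hq.mul (hH.comp measurable_fst)
    exact h.stronglyMeasurable.integral_prod_left'.measurable
  have hpt : ∀ᵐ z' ∂Pa, |(∫ x, q x z' * H x) - ∫ x, q x z * H x| ≤ M * (D l z' + D l z) := by
    filter_upwards [hac.ae_le hqi] with z' hz'
    exact abs_integral_mul_sub_integral_mul_le hz' hzi (hri l) hH hM
  have hbi : Integrable (fun z' => M * (D l z' + D l z)) Pa :=
    (hDP.add (integrable_const _)).const_mul M
  have hui : Integrable (fun z' => ∫ x, q x z' * H x) Pa := by
    have h1 : Integrable (fun z' => (∫ x, q x z' * H x) - ∫ x, q x z * H x) Pa :=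
      hbi.mono' (hu.sub_const _).aestronglyMeasurable hpt
    exact (h1.add (integrable_const (∫ x, q x z * H x))).congr
      (.of_forall fun _ => sub_add_cancel _ _)
  have h1 : (∫ z', (∫ x, q x z' * H x) ∂Pa) - ∫ x, q x z * H x =
      ∫ z', ((∫ x, q x z' * H x) - ∫ x, q x z * H x) ∂Pa := by
    rw [integral_sub hui (integrable_const _)]
    simp
  rw [h1, ← Real.norm_eq_abs]
  refine (norm_integral_le_of_norm_le hbi hpt).trans ?_
  rw [integral_const_mul, integral_add hDP (integrable_const _)]
  simp only [integral_const, probReal_univ, smul_eq_mul, one_mul]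
  gcongr
  linarith

end LebesguePoints

/-! ### Marginals and the conditional density p(x|z) -/

section Disintegration

variable {d : ℕ} {p : Vec d × Vec d × Vec d → ℝ≥0∞}

lemma measurable_margXZ (hp : Measurable p) :
    Measurable fun v : Vec d × Vec d => margXZ p v.1 v.2 := by
  have h : Measurable fun u : (Vec d × Vec d) × Vec d => p (u.1.1, u.2, u.1.2) := by fun_prop
  exact h.lintegral_prod_right'

lemma measurable_margYZ (hp : Measurable p) :
    Measurable fun v : Vec d × Vec d => margYZ p v.1 v.2 := by
  have h : Measurable fun u : (Vec d × Vec d) × Vec d => p (u.2, u.1.1, u.1.2) := by fun_prop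
  exact h.lintegral_prod_right'

lemma measurable_margZ (hp : Measurable p) : Measurable (margZ p) :=
  (measurable_margXZ hp).lintegral_prod_left'

lemma measurable_condXZ (hp : Measurable p) :
    Measurable fun v : Vec d × Vec d => condXZ p v.1 v.2 :=
  (measurable_margXZ hp).div ((measurable_margZ hp).comp measurable_snd)

lemma measurable_margXZ_left (hp : Measurable p) (z : Vec d) :
    Measurable fun x => margXZ p x z :=
  (measurable_margXZ hp).comp (measurable_id.prodMk measurable_const)

lemma map_snd_withDensity_prod {α β : Type*} [MeasurableSpace α] [MeasurableSpace β]
    (τ : Measure α) [SFinite τ] (lam : Measure β) [SFinite lam] {f : α × β → ℝ≥0∞}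
    (hf : Measurable f) :
    ((τ.prod lam).withDensity f).map Prod.snd = lam.withDensity fun b => ∫⁻ a, f (a, b) ∂τ := by
  ext s hs
  rw [Measure.map_apply measurable_snd hs, withDensity_apply _ (measurable_snd hs),
    withDensity_apply _ hs, ← lintegral_indicator (measurable_snd hs), ← lintegral_indicator hs,
    lintegral_prod_symm _ (hf.indicator (measurable_snd hs)).aemeasurable]
  congr 1 with b
  by_cases hb : b ∈ s
  · simp only [hb, Set.indicator_of_mem]
    exact lintegral_congr fun a => Set.indicator_of_mem (show (a, b) ∈ Prod.snd ⁻¹' s from hb) f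
  · simp only [hb, not_false_eq_true, Set.indicator_of_notMem]
    rw [lintegral_congr fun a => Set.indicator_of_notMem
      (show (a, b) ∉ Prod.snd ⁻¹' s from hb) f, lintegral_zero]

lemma map_withDensity_snd (hp : Measurable p) :
    (volume.withDensity p).map Prod.snd =
      volume.withDensity fun v : Vec d × Vec d => margYZ p v.1 v.2 :=
  map_snd_withDensity_prod volume volume hp

lemma map_withDensity_fst_snd_snd (hp : Measurable p) :
    (volume.withDensity p).map (fun w => (w.1, w.2.2)) =
      volume.withDensity fun v : Vec d × Vec d => margXZ p v.1 v.2 := by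
  ext s hs
  have hm : Measurable fun w : Vec d × Vec d × Vec d => (w.1, w.2.2) := by fun_prop
  have hi : Measurable fun w : Vec d × Vec d × Vec d => s.indicator 1 (w.1, w.2.2) * p w :=
    ((measurable_one.indicator hs).comp hm).mul hp
  have hi' : Measurable fun v : Vec d × Vec d => s.indicator 1 v * margXZ p v.1 v.2 :=
    (measurable_one.indicator hs).mul (measurable_margXZ hp)
  rw [Measure.map_apply hm hs, withDensity_apply _ (hm hs), withDensity_apply _ hs,
    ← lintegral_indicator (hm hs), ← lintegral_indicator hs]
  calc ∫⁻ w, ((fun w : Vec d × Vec d × Vec d => (w.1, w.2.2)) ⁻¹' s).indicator p w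
      = ∫⁻ w : Vec d × Vec d × Vec d, s.indicator 1 (w.1, w.2.2) * p w := by
        congr 1 with w
        by_cases hw : (w.1, w.2.2) ∈ s <;> simp [hw]
    _ = ∫⁻ x : Vec d, ∫⁻ v : Vec d × Vec d, s.indicator 1 (x, v.2) * p (x, v) := by
        rw [Measure.volume_eq_prod, lintegral_prod _ hi.aemeasurable]
    _ = ∫⁻ x : Vec d, ∫⁻ z : Vec d, s.indicator 1 (x, z) * margXZ p x z := by
        congr 1 with x
        have h2 : Measurable fun v : Vec d × Vec d => s.indicator 1 (x, v.2) * p (x, v) :=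
          hi.comp (measurable_const.prodMk measurable_id)
        rw [Measure.volume_eq_prod, lintegral_prod_symm _ h2.aemeasurable]
        congr 1 with z
        have h3 : Measurable fun y => p (x, y, z) := by fun_prop
        exact lintegral_const_mul (s.indicator 1 (x, z)) h3
    _ = ∫⁻ v : Vec d × Vec d, s.indicator 1 v * margXZ p v.1 v.2 := by
        rw [Measure.volume_eq_prod, lintegral_prod _ hi'.aemeasurable]
    _ = _ := by
        congr 1 with v
        by_cases hv : v ∈ s <;> simp [hv]

lemma map_withDensity_snd_snd (hp : Measurable p) :
    (volume.withDensity p).map (fun w => w.2.2) = volume.withDensity (margZ p) := by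
  have hm : Measurable fun w : Vec d × Vec d × Vec d => (w.1, w.2.2) := by fun_prop
  have h := map_snd_withDensity_prod volume volume (measurable_margXZ hp)
  rw [← Measure.volume_eq_prod, ← map_withDensity_fst_snd_snd hp,
    Measure.map_map measurable_snd hm] at h
  exact h

lemma isProbabilityMeasure_withDensity (hp1 : ∫⁻ w, p w = 1) :
    IsProbabilityMeasure (volume.withDensity p) :=
  ⟨by rw [withDensity_apply _ MeasurableSet.univ, Measure.restrict_univ, hp1]⟩

lemma lintegral_margZ (hp : Measurable p) (hp1 : ∫⁻ w, p w = 1) : ∫⁻ z, margZ p z = 1 := by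
  have := isProbabilityMeasure_withDensity hp1
  have hm : Measurable fun w : Vec d × Vec d × Vec d => w.2.2 := by fun_prop
  rw [← setLIntegral_univ, ← withDensity_apply _ MeasurableSet.univ, ← map_withDensity_snd_snd hp,
    Measure.map_apply hm MeasurableSet.univ, Set.preimage_univ, measure_univ]

lemma isProbabilityMeasure_withDensity_margZ (hp : Measurable p) (hp1 : ∫⁻ w, p w = 1) :
    IsProbabilityMeasure (volume.withDensity (margZ p)) :=
  ⟨by rw [withDensity_apply _ MeasurableSet.univ, Measure.restrict_univ, lintegral_margZ hp hp1]⟩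

/-- Almost everywhere for the law of Z, p(z) is neither 0 nor infinite, so the quotient normalizes
correctly. -/
lemma ae_lintegral_condXZ (hp : Measurable p) (hp1 : ∫⁻ w, p w = 1) :
    ∀ᵐ z ∂volume.withDensity (margZ p), ∫⁻ x, condXZ p x z = 1 := by
  rw [ae_withDensity_iff (measurable_margZ hp)]
  have hfin : ∀ᵐ z, margZ p z < ∞ :=
    ae_lt_top (measurable_margZ hp) (by rw [lintegral_margZ hp hp1]; exact ENNReal.one_ne_top)
  filter_upwards [hfin] with z hz hz0
  simp only [condXZ, div_eq_mul_inv]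
  rw [lintegral_mul_const _ (measurable_margXZ_left hp z)]
  exact ENNReal.mul_inv_cancel hz0 hz.ne

lemma withDensity_margXZ (hp : Measurable p) (hp1 : ∫⁻ w, p w = 1) :
    (volume.withDensity fun v : Vec d × Vec d => margXZ p v.1 v.2) =
      (volume.prod (volume.withDensity (margZ p))).withDensity fun v => condXZ p v.1 v.2 := by
  have hmZ := measurable_margZ hp
  have hmXZ := measurable_margXZ hp
  have hfin : ∀ᵐ z, margZ p z < ∞ :=
    ae_lt_top hmZ (by rw [lintegral_margZ hp hp1]; exact ENNReal.one_ne_top)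
  have hmZ' : Measurable fun v : Vec d × Vec d => margZ p v.2 := hmZ.comp measurable_snd
  rw [prod_withDensity_right hmZ, ← withDensity_mul _ hmZ' (measurable_condXZ hp),
    Measure.volume_eq_prod]
  refine withDensity_congr_ae ?_
  -- Where p(z) = 0, also p(x,z) = 0 for almost every x, so the value assigned to the quotient there
  -- is harmless.
  have h0 : ∀ᵐ v ∂(volume.prod volume : Measure (Vec d × Vec d)),
      margZ p v.2 = 0 → margXZ p v.1 v.2 = 0 := by
    have hs : MeasurableSet {z | margZ p z = 0} := hmZ (measurableSet_singleton 0)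
    have hi : Measurable fun v : Vec d × Vec d =>
        {z | margZ p z = 0}.indicator 1 v.2 * margXZ p v.1 v.2 :=
      ((measurable_one.indicator hs).comp measurable_snd).mul hmXZ
    have : ∫⁻ v, {z | margZ p z = 0}.indicator 1 v.2 * margXZ p v.1 v.2
        ∂(volume.prod volume : Measure (Vec d × Vec d)) = 0 := by
      rw [lintegral_prod_symm _ hi.aemeasurable]
      refine (lintegral_congr fun z => ?_).trans lintegral_zero
      dsimp only
      rw [lintegral_const_mul _ (measurable_margXZ_left hp z)]
      by_cases hz : margZ p z = 0
      · have : ∫⁻ x, margXZ p x z = 0 := hz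
        simp [this]
      · simp [hz]
    rw [lintegral_eq_zero_iff hi] at this
    filter_upwards [this] with v hv hv0
    simpa [hv0] using hv
  have h1 : ∀ᵐ v ∂(volume.prod volume : Measure (Vec d × Vec d)), margZ p v.2 < ∞ :=
    Measure.quasiMeasurePreserving_snd.ae hfin
  filter_upwards [h0, h1] with v hv0 hv1
  simp only [Pi.mul_apply, condXZ]
  exact (ENNReal.mul_div_cancel' hv0 fun h => absurd h hv1.ne).symm

lemma integral_withDensity_prod_volume {β : Type*} [MeasurableSpace β] (lam : Measure β)
    [SFinite lam] {r : Vec d × β → ℝ≥0∞} (hr : Measurable r)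
    [IsFiniteMeasure ((volume.prod lam).withDensity r)] {H : Vec d × β → ℝ} (hH : Measurable H)
    {M : ℝ} (hM : ∀ v, |H v| ≤ M) :
    ∫ v, H v ∂(volume.prod lam).withDensity r =
      ∫ b, (∫ x, (r (x, b)).toReal * H (x, b)) ∂lam := by
  have hfin : ∀ᵐ v ∂(volume.prod lam), r v < ∞ := by
    refine ae_lt_top hr ?_
    rw [← setLIntegral_univ, ← withDensity_apply _ MeasurableSet.univ]
    exact measure_ne_top _ _
  have hi : Integrable H ((volume.prod lam).withDensity r) :=
    .of_bound hH.aestronglyMeasurable M (.of_forall hM)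
  rw [integrable_withDensity_iff_integrable_smul' hr hfin] at hi
  rw [integral_withDensity_eq_integral_toReal_smul hr hfin, integral_prod_symm _ hi]
  rfl

/-- The real-valued conditional density `p(x|z)`. -/
noncomputable def realCond (p : Vec d × Vec d × Vec d → ℝ≥0∞) (x z : Vec d) : ℝ :=
  (condXZ p x z).toReal

lemma measurable_realCond (hp : Measurable p) :
    Measurable fun v : Vec d × Vec d => realCond p v.1 v.2 :=
  (measurable_condXZ hp).ennreal_toReal

lemma ae_integrable_realCond (hp : Measurable p) (hp1 : ∫⁻ w, p w = 1) :
    ∀ᵐ z ∂volume.withDensity (margZ p), Integrable fun x => realCond p x z := by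
  filter_upwards [ae_lintegral_condXZ hp hp1] with z hz
  exact integrable_toReal_of_lintegral_ne_top
    ((measurable_condXZ hp).comp (measurable_id.prodMk measurable_const)).aemeasurable
    (by rw [hz]; exact ENNReal.one_ne_top)

lemma ae_integral_abs_realCond (hp : Measurable p) (hp1 : ∫⁻ w, p w = 1) :
    ∀ᵐ z ∂volume.withDensity (margZ p), ∫ x, |realCond p x z| = 1 := by
  filter_upwards [ae_lintegral_condXZ hp hp1] with z hz
  have hm : Measurable fun x => condXZ p x z :=
    (measurable_condXZ hp).comp (measurable_id.prodMk measurable_const)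
  have hfin : ∀ᵐ x, condXZ p x z < ∞ := ae_lt_top hm (by rw [hz]; exact ENNReal.one_ne_top)
  simp only [realCond, abs_of_nonneg ENNReal.toReal_nonneg]
  rw [integral_toReal hm.aemeasurable hfin, hz, ENNReal.toReal_one]

lemma integral_comp_fst_snd_snd (hp : Measurable p) (hp1 : ∫⁻ w, p w = 1)
    {H : Vec d × Vec d → ℝ} (hH : Measurable H) {M : ℝ} (hM : ∀ v, |H v| ≤ M) :
    ∫ w, H (w.1, w.2.2) ∂volume.withDensity p =
      ∫ z, (∫ x, realCond p x z * H (x, z)) ∂volume.withDensity (margZ p) := by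
  have := isProbabilityMeasure_withDensity hp1
  have := isProbabilityMeasure_withDensity_margZ hp hp1
  have hm : Measurable fun w : Vec d × Vec d × Vec d => (w.1, w.2.2) := by fun_prop
  have heq := (map_withDensity_fst_snd_snd hp).trans (withDensity_margXZ hp hp1)
  have : IsFiniteMeasure ((volume.prod (volume.withDensity (margZ p))).withDensity
      fun v : Vec d × Vec d => condXZ p v.1 v.2) := heq ▸ inferInstance
  rw [← integral_map hm.aemeasurable hH.aestronglyMeasurable, heq]
  exact integral_withDensity_prod_volume _ (measurable_condXZ hp) hH hM

/-- The density p(x|z) p(y,z) is the conditional density taken against the law of (Y,Z). As that law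
is a marginal of p, the outer integral can be written over the full triple, the form in which
`localMean` is integrated. -/
lemma prodExpectation_eq (hp : Measurable p) (hp1 : ∫⁻ w, p w = 1)
    {g : Vec d → Vec d → Vec d → ℝ}
    (hg : Measurable fun w : Vec d × Vec d × Vec d => g w.1 w.2.1 w.2.2) {M : ℝ}
    (hM : ∀ x y z, |g x y z| ≤ M) :
    prodExpectation p g =
      ∫ w, (∫ x, realCond p x w.2.2 * g x w.2.1 w.2.2) ∂volume.withDensity p := by
  have hP := isProbabilityMeasure_withDensity hp1
  set lam := volume.withDensity fun v : Vec d × Vec d => margYZ p v.1 v.2 with hlam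
  have hlP : IsProbabilityMeasure lam := by
    rw [hlam, ← map_withDensity_snd hp]
    exact Measure.isProbabilityMeasure_map measurable_snd.aemeasurable
  have hr : Measurable fun w : Vec d × Vec d × Vec d => condXZ p w.1 w.2.2 :=
    (measurable_condXZ hp).comp (measurable_fst.prodMk (by fun_prop))
  have hQ : prodMeasure p = (volume.prod lam).withDensity fun w => condXZ p w.1 w.2.2 := by
    have hYZ : Measurable fun w : Vec d × Vec d × Vec d => margYZ p w.2.1 w.2.2 :=
      (measurable_margYZ hp).comp measurable_snd
    rw [hlam, prod_withDensity_right (measurable_margYZ hp), ← withDensity_mul _ hYZ hr,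
      prodMeasure,
      Measure.volume_eq_prod]
    congr 1
    ext w
    exact mul_comm _ _
  have hsnd : (volume.withDensity p).map (fun w => w.2.2) = lam.map Prod.snd := by
    rw [hlam, ← map_withDensity_snd hp, Measure.map_map measurable_snd measurable_snd]
    rfl
  -- The Z-marginal of `lam` is the law of Z, for which almost every conditional density has mass 1.
  have hfin : IsFiniteMeasure ((volume.prod lam).withDensity
      fun w : Vec d × Vec d × Vec d => condXZ p w.1 w.2.2) := by
    constructor
    rw [withDensity_apply _ MeasurableSet.univ, setLIntegral_univ,
      lintegral_prod_symm _ hr.aemeasurable]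
    have h1 : ∀ᵐ v ∂lam, ∫⁻ x, condXZ p x v.2 = 1 := by
      have := ae_lintegral_condXZ hp hp1
      rw [← map_withDensity_snd_snd hp, hsnd] at this
      exact ae_of_ae_map measurable_snd.aemeasurable this
    rw [lintegral_congr_ae h1]
    simp
  have hm : Measurable fun u : (Vec d × Vec d) × Vec d =>
      realCond p u.2 u.1.2 * g u.2 u.1.1 u.1.2 :=
    ((measurable_realCond hp).comp (measurable_snd.prodMk (by fun_prop))).mul
      (hg.comp (measurable_snd.prodMk measurable_fst))
  rw [prodExpectation, hQ, integral_withDensity_prod_volume lam hr hg fun v => hM _ _ _, hlam,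
    ← map_withDensity_snd hp, integral_map measurable_snd.aemeasurable]
  · rfl
  · exact hm.stronglyMeasurable.integral_prod_right'.aestronglyMeasurable

end Disintegration

/-! ### Ball sums: moments and measurability -/

section LocalAverages

variable {d : ℕ}

/-- The contribution `1{z ∈ B(z')} g(x,y',z')` of the sample point `w = (x,y,z)` to the local
average at `w' = (x',y',z')`. -/
noncomputable def localTerm (μ : Measure (Vec d)) (t : ℝ) (g : Vec d → Vec d → Vec d → ℝ)
    (w w' : Vec d × Vec d × Vec d) : ℝ :=
  (nearBall μ t w'.2.2).indicator (fun _ => g w.1 w'.2.1 w'.2.2) w.2.2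

/-- The normalized expectation of `localTerm`. -/
noncomputable def localMean (ν : Measure (Vec d × Vec d × Vec d)) (μ : Measure (Vec d)) (t : ℝ)
    (g : Vec d → Vec d → Vec d → ℝ) (w' : Vec d × Vec d × Vec d) : ℝ :=
  t⁻¹ * ∫ w, localTerm μ t g w w' ∂ν

variable {μ : Measure (Vec d)} {t : ℝ} {g : Vec d → Vec d → Vec d → ℝ} {M : ℝ}

lemma abs_localTerm_le (hM : ∀ x y z, |g x y z| ≤ M) (w w' : Vec d × Vec d × Vec d) :
    |localTerm μ t g w w'| ≤ M := by
  have hM0 : 0 ≤ M := (abs_nonneg _).trans (hM 0 0 0)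
  by_cases h : w.2.2 ∈ nearBall μ t w'.2.2 <;> simp [localTerm, h, hM, hM0]

variable [IsProbabilityMeasure μ] {ν : Measure (Vec d × Vec d × Vec d)}

lemma integral_indicator_nearBall (hd : 0 < d) (hμ : μ ≪ volume)
    (hνμ : ν.map (fun w => w.2.2) = μ) (ht0 : 0 < t) (ht1 : t < 1) (c : ℝ) (ζ : Vec d) :
    ∫ w, (nearBall μ t ζ).indicator (fun _ => c) w.2.2 ∂ν = t * c := by
  have hm : Measurable fun w : Vec d × Vec d × Vec d => w.2.2 := by fun_prop
  have hB := measurableSet_nearBall μ t ζ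
  have hi : Measurable ((nearBall μ t ζ).indicator fun _ => c) := measurable_const.indicator hB
  rw [← integral_map (φ := fun w : Vec d × Vec d × Vec d => w.2.2) hm.aemeasurable
    hi.aestronglyMeasurable, hνμ, integral_indicator_const _ hB, measureReal_def,
    measure_nearBall μ hd hμ ht0 ht1, ENNReal.toReal_ofReal ht0.le, smul_eq_mul]

lemma integral_localTerm_one (hd : 0 < d) (hμ : μ ≪ volume)
    (hνμ : ν.map (fun w => w.2.2) = μ) (ht0 : 0 < t) (ht1 : t < 1)
    (w' : Vec d × Vec d × Vec d) : ∫ w, localTerm μ t (fun _ _ _ => 1) w w' ∂ν = t := by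
  simpa [localTerm] using integral_indicator_nearBall hd hμ hνμ ht0 ht1 1 w'.2.2

lemma measurable_localTerm (hg : Measurable fun w : Vec d × Vec d × Vec d => g w.1 w.2.1 w.2.2) :
    Measurable fun u : (Vec d × Vec d × Vec d) × (Vec d × Vec d × Vec d) =>
      localTerm μ t g u.1 u.2 := by
  have hf : Measurable fun u : (Vec d × Vec d × Vec d) × (Vec d × Vec d × Vec d) =>
      (u.1.2.2, u.2.2.2) := by fun_prop
  have hG : Measurable fun u : (Vec d × Vec d × Vec d) × (Vec d × Vec d × Vec d) =>
      g u.1.1 u.2.2.1 u.2.2.2 := by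
    have h : Measurable fun u : (Vec d × Vec d × Vec d) × (Vec d × Vec d × Vec d) =>
      (u.1.1, u.2.2.1, u.2.2.2) := by fun_prop
    exact hg.comp h
  exact hG.indicator (hf (measurableSet_nearBall_prod μ t))

variable [IsProbabilityMeasure ν]

lemma measurable_localMean
    (hg : Measurable fun w : Vec d × Vec d × Vec d => g w.1 w.2.1 w.2.2) :
    Measurable (localMean ν μ t g) :=
  ((measurable_localTerm hg).stronglyMeasurable.integral_prod_left'.measurable).const_mul _

lemma integrable_indicator_nearBall (c : ℝ) (ζ : Vec d) :
    Integrable (fun w : Vec d × Vec d × Vec d => (nearBall μ t ζ).indicator (fun _ => c) w.2.2)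
      ν := by
  have hm : Measurable fun w : Vec d × Vec d × Vec d => w.2.2 := by fun_prop
  refine .of_bound (((measurable_const.indicator (measurableSet_nearBall μ t ζ)).comp
    hm).aestronglyMeasurable) |c| (.of_forall fun w => ?_)
  by_cases h : w.2.2 ∈ nearBall μ t ζ <;> simp [h]

/-- The term vanishes outside a ball of measure `t`; summed over `N` points the second moments give
only `N t M² = k M²`. -/
lemma integral_localTerm_sq_le (hd : 0 < d) (hμ : μ ≪ volume)
    (hνμ : ν.map (fun w => w.2.2) = μ) (ht0 : 0 < t) (ht1 : t < 1)
    (hM : ∀ x y z, |g x y z| ≤ M) (w' : Vec d × Vec d × Vec d) :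
    ∫ w, localTerm μ t g w w' ^ 2 ∂ν ≤ t * M ^ 2 := by
  rw [← integral_indicator_nearBall hd hμ hνμ ht0 ht1 (M ^ 2) w'.2.2]
  refine integral_mono_of_nonneg (.of_forall fun w => sq_nonneg _)
    (integrable_indicator_nearBall _ _) (.of_forall fun w => ?_)
  by_cases h : w.2.2 ∈ nearBall μ t w'.2.2
  · simpa [localTerm, h] using sq_le_sq' (abs_le.1 (hM _ _ _)).1 (abs_le.1 (hM _ _ _)).2
  · simp [localTerm, h]

lemma abs_localMean_le (hd : 0 < d) (hμ : μ ≪ volume)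
    (hνμ : ν.map (fun w => w.2.2) = μ) (ht0 : 0 < t) (ht1 : t < 1)
    (hM : ∀ x y z, |g x y z| ≤ M) (w' : Vec d × Vec d × Vec d) :
    |localMean ν μ t g w'| ≤ M := by
  have h : ‖∫ w, localTerm μ t g w w' ∂ν‖ ≤ t * M := by
    rw [← integral_indicator_nearBall hd hμ hνμ ht0 ht1 M w'.2.2]
    refine norm_integral_le_of_norm_le (integrable_indicator_nearBall _ _) (.of_forall fun w => ?_)
    by_cases h : w.2.2 ∈ nearBall μ t w'.2.2 <;> simp [localTerm, h, hM]
  rw [localMean, abs_mul, abs_of_pos (inv_pos.2 ht0), inv_mul_le_iff₀ ht0]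
  exact h

end LocalAverages

/-! ### Convergence of the expected local average -/

section Convergence

variable {d : ℕ} {p : Vec d × Vec d × Vec d → ℝ≥0∞} {g : Vec d → Vec d → Vec d → ℝ} {M : ℝ}

lemma localMean_eq_average (hd : 0 < d) (hp : Measurable p) (hp1 : ∫⁻ w, p w = 1)
    (hg : Measurable fun w : Vec d × Vec d × Vec d => g w.1 w.2.1 w.2.2)
    (hM : ∀ x y z, |g x y z| ≤ M) {t : ℝ} (ht0 : 0 < t) (ht1 : t < 1)
    (w' : Vec d × Vec d × Vec d) :
    localMean (volume.withDensity p) (volume.withDensity (margZ p)) t g w' =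
      ⨍ z in nearBall (volume.withDensity (margZ p)) t w'.2.2,
        (∫ x, realCond p x z * g x w'.2.1 w'.2.2) ∂volume.withDensity (margZ p) := by
  have := isProbabilityMeasure_withDensity_margZ hp hp1
  set μ := volume.withDensity (margZ p) with hμ
  have hB := measurableSet_nearBall μ t w'.2.2
  have hgx : Measurable fun v : Vec d × Vec d => g v.1 w'.2.1 w'.2.2 :=
    hg.comp (measurable_fst.prodMk measurable_const)
  have hH : Measurable fun v : Vec d × Vec d =>
      (nearBall μ t w'.2.2).indicator (fun _ => g v.1 w'.2.1 w'.2.2) v.2 :=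
    hgx.indicator (measurable_snd hB)
  have hHM (v : Vec d × Vec d) :
      |(nearBall μ t w'.2.2).indicator (fun _ => g v.1 w'.2.1 w'.2.2) v.2| ≤ M :=
    -- The middle coordinate is arbitrary: `localTerm` ignores the y-component of its first
    -- argument.
    abs_localTerm_le hM (v.1, v.1, v.2) w'
  have key := integral_comp_fst_snd_snd hp hp1 hH hHM
  rw [setAverage_eq, measureReal_def,
    measure_nearBall μ hd (withDensity_absolutelyContinuous _ _) ht0 ht1,
    ENNReal.toReal_ofReal ht0.le, smul_eq_mul, localMean, ← integral_indicator hB]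
  congr 1
  refine key.trans (integral_congr_ae (.of_forall fun z => ?_))
  by_cases hz : z ∈ nearBall μ t w'.2.2 <;> simp [hz]

/-- The expected local average converges to the expectation under `p(x|z) p(y,z)`. -/
lemma tendsto_integral_localMean (hd : 0 < d) (hp : Measurable p) (hp1 : ∫⁻ w, p w = 1)
    (hg : Measurable fun w : Vec d × Vec d × Vec d => g w.1 w.2.1 w.2.2)
    (hM : ∀ x y z, |g x y z| ≤ M) {t : ℕ → ℝ} (ht0 : ∀ᶠ n in atTop, 0 < t n)
    (ht : Tendsto t atTop (𝓝 0)) :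
    Tendsto (fun n => ∫ w, localMean (volume.withDensity p) (volume.withDensity (margZ p)) (t n) g w
      ∂volume.withDensity p) atTop (𝓝 (prodExpectation p g)) := by
  have := isProbabilityMeasure_withDensity hp1
  have := isProbabilityMeasure_withDensity_margZ hp hp1
  have hm : Measurable fun w : Vec d × Vec d × Vec d => w.2.2 := by fun_prop
  set μ := volume.withDensity (margZ p) with hμ
  have hac : μ ≪ volume := withDensity_absolutelyContinuous _ _
  have hνμ : (volume.withDensity p).map (fun w => w.2.2) = μ := map_withDensity_snd_snd hp
  have ht1 : ∀ᶠ n in atTop, t n < 1 := ht.eventually (gt_mem_nhds one_pos)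
  rw [prodExpectation_eq hp hp1 hg hM]
  refine tendsto_integral_filter_of_dominated_convergence (fun _ => M)
    (.of_forall fun n => (measurable_localMean hg).aestronglyMeasurable) ?_ (integrable_const M) ?_
  · filter_upwards [ht0, ht1] with n h0 h1
    exact .of_forall fun w => abs_localMean_le hd hac hνμ h0 h1 hM w
  · have h1 := ae_eventually_abs_average_integral_sub_le (measurable_realCond hp)
      (ae_integrable_realCond hp hp1) ((ae_integral_abs_realCond hp hp1).mono fun z hz => hz.le)
    have h2 := ae_tendsto_nearBall_filterAt μ hd hac ht0 ht
    have hq : Measure.QuasiMeasurePreserving (fun w : Vec d × Vec d × Vec d => w.2.2)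
        (volume.withDensity p) μ := ⟨hm, hνμ.le.absolutelyContinuous⟩
    filter_upwards [hq.ae h1, hq.ae h2] with w hw1 hw2
    rw [Metric.tendsto_nhds]
    intro δ hδ
    have hM0 : 0 ≤ M := (abs_nonneg _).trans (hM 0 0 0)
    -- Dividing by `M + 1` rather than `M` allows `M = 0` and makes the final inequality strict.
    filter_upwards [ht0, ht1, hw2.eventually (hw1 (δ / (M + 1)) (by positivity))] with n h0 h1 hn
    rw [Real.dist_eq, localMean_eq_average hd hp hp1 hg hM h0 h1]
    refine lt_of_le_of_lt (hn M (fun x => g x w.2.1 w.2.2)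
      (hg.comp (measurable_id.prodMk measurable_const)) fun x => hM _ _ _) ?_
    rw [mul_div_assoc', div_lt_iff₀ (by positivity)]
    nlinarith

end Convergence

/-! ### Two-sided deviations -/

section TwoSided

variable {α : Type*} [MeasurableSpace α] (ν : Measure α) [IsProbabilityMeasure ν]

/-- The two-sided form of `measure_pi_sum_centered_ge_le_of_notMem`. -/
lemma measure_pi_abs_sum_centered_ge_le_of_notMem {ι : Type*} [Fintype ι] [DecidableEq ι]
    {h : α → α → ℝ} (hh : Measurable fun q : α × α => h q.1 q.2) {M : ℝ}
    (hM : ∀ a b, |h a b| ≤ M) {v : ℝ} (hv : ∀ b, ∫ a, h a b ^ 2 ∂ν ≤ v) {l : ℝ} (hl : 0 ≤ l)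
    (hlM : l * M ≤ 1) (J : Finset ι) {i : ι} (hi : i ∉ J) (a : ℝ) :
    (Measure.pi fun _ : ι => ν) {w | a ≤ |∑ j ∈ J, (h (w j) (w i) - ∫ b, h b (w i) ∂ν)|} ≤
      2 * ENNReal.ofReal (Real.exp (-l * a + J.card * (l ^ 2 * v))) := by
  have h1 := measure_pi_sum_centered_ge_le_of_notMem ν hh hM hv hl hlM J hi a
  have h2 := measure_pi_sum_centered_ge_le_of_notMem ν (h := fun a b => -h a b) hh.neg
    (fun a b => by simpa using hM a b) (fun b => by simpa using hv b) hl hlM J hi a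
  rw [two_mul]
  refine (measure_mono fun w hw => ?_).trans ((measure_union_le _ _).trans (add_le_add h1 h2))
  rcases le_abs.1 (show a ≤ |_| from hw) with h | h
  · exact Or.inl h
  · refine Or.inr ?_
    simp only [Set.mem_ofPred_eq, integral_neg]
    rw [← Finset.sum_neg_distrib] at h
    refine h.trans_eq (Finset.sum_congr rfl fun j _ => by ring)

end TwoSided

/-! ### Deviation bounds for a fixed isolated set -/

section FixedSample

variable {d n : ℕ} {ν : Measure (Vec d × Vec d × Vec d)} {μ : Measure (Vec d)} {t : ℝ}
  {g : Vec d → Vec d → Vec d → ℝ} {M η : ℝ} {s : Finset (Fin n)} {k : ℕ}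

/-- The samples for which some local average over the complement of `s`, some count of points in
a ball, or the average of the local means over `s` deviates from its expectation. -/
def deviationSet (ν : Measure (Vec d × Vec d × Vec d)) (μ : Measure (Vec d)) (t : ℝ)
    (g : Vec d → Vec d → Vec d → ℝ) (η : ℝ) (s : Finset (Fin n)) (k : ℕ) :
    Set (Fin n → Vec d × Vec d × Vec d) :=
  ((⋃ i ∈ s, {w | η * k ≤
      |∑ j ∈ sᶜ, (localTerm μ t g (w j) (w i) - ∫ b, localTerm μ t g b (w i) ∂ν)|}) ∪
    ⋃ i ∈ s, {w | η * k ≤ |∑ j ∈ sᶜ, (localTerm μ t (fun _ _ _ => 1) (w j) (w i) -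
      ∫ b, localTerm μ t (fun _ _ _ => 1) b (w i) ∂ν)|}) ∪
    {w | η * s.card ≤ |∑ i ∈ s, (localMean ν μ t g (w i) - ∫ b, localMean ν μ t g b ∂ν)|}

/-- Off `deviationSet`, the isolated nearest neighbour average is close to its limit in mean. -/
lemma abs_empAverage_sub_le (hd : 0 < d) [IsProbabilityMeasure μ] (hμ : μ ≪ volume)
    (hνμ : ν.map (fun w => w.2.2) = μ) (hM : ∀ x y z, |g x y z| ≤ M) (hk : 0 < k)
    (hs : 0 < s.card) (hkN : k < sᶜ.card) (ht : t = k / (sᶜ.card : ℝ))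
    {w : Fin n → Vec d × Vec d × Vec d} (hw : w ∉ deviationSet ν μ t g η s k)
    {A : Vec d → Finset (Fin n)}
    (hA : ∀ i ∈ s, IsKNearest (fun j => (w j).2.2) sᶜ k (w i).2.2 (A (w i).2.2)) :
    |empAverage g s.card k s A (fun j => (w j).1) (fun j => (w j).2.1) (fun j => (w j).2.2) -
      ∫ b, localMean ν μ t g b ∂ν| ≤ (M + 2) * η := by
  have hM0 : 0 ≤ M := (abs_nonneg _).trans (hM 0 0 0)
  have hk' : (0 : ℝ) < k := Nat.cast_pos.2 hk
  have hs' : (0 : ℝ) < s.card := Nat.cast_pos.2 hs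
  have hN' : (0 : ℝ) < sᶜ.card := Nat.cast_pos.2 (hk.trans hkN)
  have ht0 : 0 < t := by rw [ht]; positivity
  have ht1 : t < 1 := by
    rw [ht, div_lt_one hN']
    exact_mod_cast hkN
  have hNt : (sᶜ.card : ℝ) * t = k := by rw [ht]; field_simp
  simp only [deviationSet, Set.mem_union, Set.mem_iUnion, Set.mem_ofPred_eq, not_or, not_exists,
    not_le] at hw
  obtain ⟨⟨hw1, hw2⟩, hw3⟩ := hw
  have hterm (i : Fin n) (hi : i ∈ s) :
      |(1 / (k : ℝ)) * ∑ j ∈ A (w i).2.2, g (w j).1 (w i).2.1 (w i).2.2 -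
        localMean ν μ t g (w i)| ≤ (M + 1) * η := by
    obtain ⟨ρ, -, hB, -⟩ := exists_nearBall_eq_closedBall μ hd hμ ht0 ht1 (w i).2.2
    have hsum (G : Vec d → Vec d → Vec d → ℝ) : ∑ j ∈ sᶜ, localTerm μ t G (w j) (w i) =
        ∑ j ∈ sᶜ.filter (fun j => dist (w j).2.2 (w i).2.2 ≤ ρ),
          G (w j).1 (w i).2.1 (w i).2.2 := by
      rw [Finset.sum_filter]
      refine Finset.sum_congr rfl fun j _ => ?_
      rw [localTerm, hB]
      by_cases h : dist (w j).2.2 (w i).2.2 ≤ ρ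
      · rw [Set.indicator_of_mem (Metric.mem_closedBall.2 h), if_pos h]
      · rw [Set.indicator_of_notMem (fun h' => h (Metric.mem_closedBall.1 h')), if_neg h]
    have h1 := (hA i hi).abs_sum_sub_sum_le ρ (v := fun j => g (w j).1 (w i).2.1 (w i).2.2)
      fun j => hM _ _ _
    have h2 := hw1 i hi
    have h3 := hw2 i hi
    rw [Finset.sum_sub_distrib, Finset.sum_const, nsmul_eq_mul, hsum] at h2 h3
    rw [integral_localTerm_one hd hμ hνμ ht0 ht1, hNt, Finset.sum_const, nsmul_eq_mul,
      mul_one] at h3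
    have h4 : (sᶜ.card : ℝ) * ∫ b, localTerm μ t g b (w i) ∂ν = k * localMean ν μ t g (w i) := by
      rw [localMean, ← hNt]
      field_simp
    rw [h4] at h2
    have h5 : (1 / (k : ℝ)) * ∑ j ∈ A (w i).2.2, g (w j).1 (w i).2.1 (w i).2.2 -
        localMean ν μ t g (w i) = (1 / (k : ℝ)) *
          (∑ j ∈ A (w i).2.2, g (w j).1 (w i).2.1 (w i).2.2 - k * localMean ν μ t g (w i)) := by
      field_simp
    rw [h5, abs_mul, abs_of_pos (by positivity), one_div, inv_mul_le_iff₀ hk']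
    -- The count deviation contributes `M * η` and the ball sum `η`; averaging the local means over
    -- `s` will add another `η`.
    have h6 := mul_le_mul_of_nonneg_left h3.le hM0
    refine (abs_sub_le _ _ _).trans ((add_le_add (h1.trans h6) h2.le).trans_eq ?_)
    ring
  have hdiff : |empAverage g s.card k s A (fun j => (w j).1) (fun j => (w j).2.1)
      (fun j => (w j).2.2) - (1 / (s.card : ℝ)) * ∑ i ∈ s, localMean ν μ t g (w i)| ≤
      (M + 1) * η := by
    rw [empAverage, ← mul_sub, ← Finset.sum_sub_distrib, abs_mul, abs_of_pos (by positivity),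
      one_div, inv_mul_le_iff₀ hs', ← nsmul_eq_mul]
    exact (Finset.abs_sum_le_sum_abs _ _).trans (Finset.sum_le_card_nsmul _ _ _ hterm)
  have hmean : |(1 / (s.card : ℝ)) * ∑ i ∈ s, localMean ν μ t g (w i) -
      ∫ b, localMean ν μ t g b ∂ν| ≤ η := by
    rw [Finset.sum_sub_distrib, Finset.sum_const, nsmul_eq_mul] at hw3
    have h5 : (1 / (s.card : ℝ)) * ∑ i ∈ s, localMean ν μ t g (w i) -
        ∫ b, localMean ν μ t g b ∂ν = (1 / (s.card : ℝ)) *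
          (∑ i ∈ s, localMean ν μ t g (w i) - s.card * ∫ b, localMean ν μ t g b ∂ν) := by
      field_simp
    rw [h5, abs_mul, abs_of_pos (by positivity), one_div, inv_mul_le_iff₀ hs', mul_comm _ η]
    exact hw3.le
  refine (abs_sub_le _ _ _).trans ((add_le_add hdiff hmean).trans_eq ?_)
  ring

/-- The exponential rate in the deviation bound. -/
noncomputable def rate (M η : ℝ) : ℝ := min (1 / M) (η / (2 * M ^ 2)) * η / 2

lemma rate_pos (hM : 1 ≤ M) (hη : 0 < η) : 0 < rate M η := by
  have : 0 < M := by linarith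
  have : 0 < min (1 / M) (η / (2 * M ^ 2)) := lt_min (by positivity) (by positivity)
  rw [rate]
  positivity

lemma measure_deviationSet_le (hd : 0 < d) [IsProbabilityMeasure ν] [IsProbabilityMeasure μ]
    (hμ : μ ≪ volume) (hνμ : ν.map (fun w => w.2.2) = μ)
    (hg : Measurable fun w : Vec d × Vec d × Vec d => g w.1 w.2.1 w.2.2)
    (hM : ∀ x y z, |g x y z| ≤ M) (hM1 : 1 ≤ M) (hη : 0 < η) (hk : 0 < k)
    (hks : k ≤ s.card) (hkN : k < sᶜ.card) (ht : t = k / (sᶜ.card : ℝ)) :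
    (Measure.pi fun _ : Fin n => ν) (deviationSet ν μ t g η s k) ≤
      ENNReal.ofReal ((4 * n + 2) * Real.exp (-(rate M η * k))) := by
  have hM0 : 0 < M := by linarith
  have hk' : (0 : ℝ) < k := Nat.cast_pos.2 hk
  have hN' : (0 : ℝ) < sᶜ.card := Nat.cast_pos.2 (hk.trans hkN)
  have ht0 : 0 < t := by rw [ht]; positivity
  have ht1 : t < 1 := by
    rw [ht, div_lt_one hN']
    exact_mod_cast hkN
  have hNt : (sᶜ.card : ℝ) * t = k := by rw [ht]; field_simp
  have hrate := rate_pos hM1 hη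
  -- The first bound keeps the exponent in the range of the quadratic inequality; the second makes
  -- the variance term at most half of the linear gain, leaving `l * η / 2`.
  set l := min (1 / M) (η / (2 * M ^ 2)) with hl
  have hr : rate M η = l * η / 2 := rfl
  have hl0 : 0 < l := lt_min (by positivity) (by positivity)
  have hlM : l * M ≤ 1 := (le_div_iff₀ hM0).1 (min_le_left _ _)
  have hlη : l * (2 * M ^ 2) ≤ η := (le_div_iff₀ (by positivity)).1 (min_le_right _ _)
  set e := ENNReal.ofReal (Real.exp (-(rate M η * k))) with he
  -- Used with `a = k` for the ball sums and `a = s.card ≥ k` for the average of local means.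
  have hexp {a : ℝ} (ha : (k : ℝ) ≤ a) : -l * (η * a) + a * (l ^ 2 * M ^ 2) ≤ -(rate M η * k) := by
    have h1 : l * (l * (2 * M ^ 2)) ≤ l * η := mul_le_mul_of_nonneg_left hlη hl0.le
    have h2 : rate M η * k ≤ rate M η * a := mul_le_mul_of_nonneg_left ha hrate.le
    have h3 : a * (l * (l * (2 * M ^ 2))) ≤ a * (l * η) :=
      mul_le_mul_of_nonneg_left h1 (hk'.le.trans ha)
    rw [hr] at h2 ⊢
    linarith
  have hball {G : Vec d → Vec d → Vec d → ℝ}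
      (hG : Measurable fun w : Vec d × Vec d × Vec d => G w.1 w.2.1 w.2.2)
      (hGM : ∀ x y z, |G x y z| ≤ M) (i : Fin n) (hi : i ∈ s) :
      (Measure.pi fun _ : Fin n => ν) {w | η * k ≤
        |∑ j ∈ sᶜ, (localTerm μ t G (w j) (w i) - ∫ b, localTerm μ t G b (w i) ∂ν)|} ≤ 2 * e := by
    refine (measure_pi_abs_sum_centered_ge_le_of_notMem ν (measurable_localTerm hG)
      (fun a b => abs_localTerm_le hGM a b)
      (integral_localTerm_sq_le hd hμ hνμ ht0 ht1 hGM) hl0.le hlM sᶜ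
      (by simpa using hi) (η * k)).trans ?_
    gcongr
    refine ENNReal.ofReal_le_ofReal (Real.exp_le_exp.2 (le_trans (le_of_eq ?_) (hexp le_rfl)))
    rw [← hNt]
    ring
  have hunion {G : Vec d → Vec d → Vec d → ℝ}
      (hG : Measurable fun w : Vec d × Vec d × Vec d => G w.1 w.2.1 w.2.2)
      (hGM : ∀ x y z, |G x y z| ≤ M) :
      (Measure.pi fun _ : Fin n => ν) (⋃ i ∈ s, {w | η * k ≤
        |∑ j ∈ sᶜ, (localTerm μ t G (w j) (w i) - ∫ b, localTerm μ t G b (w i) ∂ν)|}) ≤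
        n * (2 * e) := by
    refine (measure_biUnion_finset_le _ _).trans ((Finset.sum_le_card_nsmul _ _ _
      (hball hG hGM)).trans ?_)
    rw [nsmul_eq_mul]
    gcongr
    simpa using Finset.card_le_univ s
  have hmean : (Measure.pi fun _ : Fin n => ν) {w | η * s.card ≤
      |∑ i ∈ s, (localMean ν μ t g (w i) - ∫ b, localMean ν μ t g b ∂ν)|} ≤ 2 * e := by
    -- The summand does not depend on the frozen coordinate, so any index outside `s` serves.
    obtain ⟨i, hi⟩ : sᶜ.Nonempty := Finset.card_pos.1 (hk.trans hkN)
    have hψ := abs_localMean_le (g := g) hd hμ hνμ ht0 ht1 hM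
    refine (measure_pi_abs_sum_centered_ge_le_of_notMem ν
      (h := fun w _ => localMean ν μ t g w) ((measurable_localMean hg).comp measurable_fst)
      (fun a _ => hψ a) (v := M ^ 2) (fun _ => ?_) hl0.le hlM s
      (by simpa using hi) (η * s.card)).trans ?_
    · have h := integral_mono_of_nonneg (μ := ν) (f := fun a => localMean ν μ t g a ^ 2)
        (g := fun _ => M ^ 2) (.of_forall fun a => sq_nonneg _) (integrable_const _)
        (.of_forall fun a => sq_le_sq' (abs_le.1 (hψ a)).1 (abs_le.1 (hψ a)).2)
      simpa using h
    · gcongr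
      exact ENNReal.ofReal_le_ofReal (Real.exp_le_exp.2 (hexp (Nat.cast_le.2 hks)))
  -- Two unions of at most `n` events and one mean, each of probability at most `2 * e`: in total
  -- `(4n+2) e`. The counts are the case g = 1, hence the need for `1 ≤ M`.
  refine (measure_union_le _ _).trans ((add_le_add ((measure_union_le _ _).trans
    (add_le_add (hunion hg hM) (hunion measurable_const fun _ _ _ => by simpa using hM1)))
    hmean).trans_eq ?_)
  rw [ENNReal.ofReal_mul (by positivity), ← he, ENNReal.ofReal_add (by positivity) (by positivity),
    ENNReal.ofReal_mul (by positivity), ENNReal.ofReal_natCast, ENNReal.ofReal_ofNat,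
    ENNReal.ofReal_ofNat]
  ring

end FixedSample

/-! ### Comparison of exponential rates -/

section Growth

variable {k m : ℕ → ℕ}

lemma eventually_sqrt_le_of_isTheta {ε₀ : ℝ} (hε₀ : 0 < ε₀)
    (hk : Asymptotics.IsTheta atTop (fun n : ℕ => (k n : ℝ))
      (fun n : ℕ => (n : ℝ) ^ (1 / 2 + ε₀ : ℝ))) :
    ∃ C > 0, ∀ᶠ n : ℕ in atTop, C * √(n : ℝ) ≤ k n := by
  obtain ⟨C, hC, h⟩ := hk.2.exists_pos
  refine ⟨C⁻¹, inv_pos.2 hC, ?_⟩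
  filter_upwards [h.bound, eventually_ge_atTop 1] with n hn hn1
  rw [Real.norm_of_nonneg (by positivity), Real.norm_of_nonneg (by positivity)] at hn
  rw [inv_mul_le_iff₀ hC, Real.sqrt_eq_rpow]
  exact (Real.rpow_le_rpow_of_exponent_le (Nat.one_le_cast.2 hn1) (by linarith)).trans hn

lemma eventually_pos_of_isTheta {ε₀ : ℝ} (hε₀ : 0 < ε₀)
    (hk : Asymptotics.IsTheta atTop (fun n : ℕ => (k n : ℝ))
      (fun n : ℕ => (n : ℝ) ^ (1 / 2 + ε₀ : ℝ))) : ∀ᶠ n in atTop, 0 < k n := by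
  obtain ⟨C, hC, h⟩ := eventually_sqrt_le_of_isTheta hε₀ hk
  filter_upwards [h, eventually_gt_atTop 0] with n hn hn0
  have : (0 : ℝ) < n := Nat.cast_pos.2 hn0
  exact Nat.cast_pos.1 (lt_of_lt_of_le (by positivity) hn)

/-- As `k/n → 0` and `k` grows at least as `√n`, the term `exp (- D k² / n)` dominates
`n exp (- a k)`. -/
lemma eventually_mul_exp_neg_le {ε₀ : ℝ} (hε₀ : 0 < ε₀)
    (hk : Asymptotics.IsTheta atTop (fun n : ℕ => (k n : ℝ))
      (fun n : ℕ => (n : ℝ) ^ (1 / 2 + ε₀ : ℝ)))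
    (hkm : ∀ᶠ n in atTop, k n ≤ m n ∧ m n + k n ≤ n)
    (hknm : Tendsto (fun n : ℕ => (k n : ℝ) / ((n : ℝ) - (m n : ℝ))) atTop (𝓝 0))
    {a D : ℝ} (ha : 0 < a) (hD : 0 < D) :
    ∀ᶠ n : ℕ in atTop, (4 * n + 2) * Real.exp (-(a * k n)) ≤
      2 * Real.exp (-(D * (k n : ℝ) ^ 2 / n)) := by
  obtain ⟨C, hC, hkC⟩ := eventually_sqrt_le_of_isTheta hε₀ hk
  set b := a / 2 * C with hb
  have hb0 : 0 < b := by positivity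
  filter_upwards [hkC, hkm, hknm.eventually (gt_mem_nhds (show 0 < a / (2 * D) by positivity)),
    eventually_pos_of_isTheta hε₀ hk, eventually_ge_atTop 1,
    tendsto_natCast_atTop_atTop.eventually_ge_atTop (72 / b ^ 4)] with n hn hm hq hk0 hn1 hn4
  have hk0' : (0 : ℝ) < k n := Nat.cast_pos.2 hk0
  have hn1' : (1 : ℝ) ≤ n := Nat.one_le_cast.2 hn1
  have hn0 : (0 : ℝ) < n := by linarith
  have hmk : (m n : ℝ) + k n ≤ n := by exact_mod_cast hm.2
  have hm0 : (0 : ℝ) ≤ m n := Nat.cast_nonneg _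
  -- Since `k/n ≤ k/(n-m) → 0`, half of the exponent `a k` dominates `D k² / n`; the other half
  -- absorbs the factor `2n+1`.
  have hkn : (k n : ℝ) / n ≤ a / (2 * D) :=
    (div_le_div_of_nonneg_left hk0'.le (by linarith) (by linarith)).trans hq.le
  have h1 : D * (k n : ℝ) ^ 2 / n ≤ a / 2 * k n := by
    calc D * (k n : ℝ) ^ 2 / n = D * (k n / n) * k n := by ring
      _ ≤ D * (a / (2 * D)) * k n := by gcongr
      _ = a / 2 * k n := by field_simp
  have h2 : 2 * (n : ℝ) + 1 ≤ Real.exp (a / 2 * k n) := by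
    have h3 : b * √(n : ℝ) ≤ a / 2 * k n := by
      rw [hb, mul_assoc]
      gcongr
    refine le_trans ?_ (Real.exp_le_exp.2 h3)
    -- The fourth Taylor term of exp at b√n is `b⁴n²/24`, which is at least `3n ≥ 2n+1` once `b⁴n ≥
    -- 72`.
    refine le_trans ?_ (Real.pow_div_factorial_le_exp (b * √(n : ℝ)) (by positivity) 4)
    have h4 : (b * √(n : ℝ)) ^ 4 = b ^ 4 * n * n := by
      have : √(n : ℝ) ^ 4 = n * n := by
        rw [show (4 : ℕ) = 2 * 2 from rfl, pow_mul, Real.sq_sqrt hn0.le, sq]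
      rw [mul_pow, this]
      ring
    rw [h4, show ((Nat.factorial 4 : ℕ) : ℝ) = 24 by norm_num [Nat.factorial]]
    have h5 : 72 ≤ b ^ 4 * n := by
      rw [div_le_iff₀ (by positivity)] at hn4
      linarith
    rw [le_div_iff₀ (by norm_num)]
    nlinarith
  calc (4 * (n : ℝ) + 2) * Real.exp (-(a * k n))
      = 2 * ((2 * (n : ℝ) + 1) * Real.exp (-(a * k n))) := by ring
    _ ≤ 2 * (Real.exp (a / 2 * k n) * Real.exp (-(a * k n))) := by gcongr
    _ = 2 * Real.exp (-(a / 2 * k n)) := by rw [← Real.exp_add]; ring_nf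
    _ ≤ 2 * Real.exp (-(D * (k n : ℝ) ^ 2 / n)) := by gcongr

end Growth

/-! ### Reduction to a globally bounded g -/

section Support

variable {d : ℕ} {p : Vec d × Vec d × Vec d → ℝ≥0∞} {S : Set (Vec d)}

lemma ae_withDensity_mem (hp : Measurable p)
    (hpS : ∀ x y z, ¬ (x ∈ S ∧ y ∈ S ∧ z ∈ S) → p (x, y, z) = 0) :
    ∀ᵐ w ∂volume.withDensity p, w.1 ∈ S ∧ w.2.1 ∈ S ∧ w.2.2 ∈ S := by
  rw [ae_withDensity_iff hp]
  exact .of_forall fun w hw => not_not.1 fun h => hw (hpS _ _ _ h)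

lemma ae_prodMeasure_mem (hp : Measurable p)
    (hpS : ∀ x y z, ¬ (x ∈ S ∧ y ∈ S ∧ z ∈ S) → p (x, y, z) = 0) :
    ∀ᵐ w ∂prodMeasure p, w.1 ∈ S ∧ w.2.1 ∈ S ∧ w.2.2 ∈ S := by
  have hr : Measurable fun w : Vec d × Vec d × Vec d =>
      condXZ p w.1 w.2.2 * margYZ p w.2.1 w.2.2 := by
    have h : Measurable fun w : Vec d × Vec d × Vec d => (w.1, w.2.2) := by fun_prop
    exact ((measurable_condXZ hp).comp h).mul ((measurable_margYZ hp).comp measurable_snd)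
  rw [prodMeasure, ae_withDensity_iff hr]
  refine .of_forall fun w hw => not_not.1 fun h => hw ?_
  by_cases hxz : w.1 ∈ S ∧ w.2.2 ∈ S
  · have hy : w.2.1 ∉ S := fun hy => h ⟨hxz.1, hy, hxz.2⟩
    have : margYZ p w.2.1 w.2.2 = 0 :=
      (lintegral_congr fun x => hpS x _ _ fun h' => hy h'.2.1).trans lintegral_zero
    rw [this, mul_zero]
  · have : margXZ p w.1 w.2.2 = 0 :=
      (lintegral_congr fun y => hpS _ y _ fun h' => hxz ⟨h'.1, h'.2.2⟩).trans lintegral_zero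
    rw [condXZ, this, ENNReal.zero_div, zero_mul]

lemma prodExpectation_congr (hp : Measurable p)
    (hpS : ∀ x y z, ¬ (x ∈ S ∧ y ∈ S ∧ z ∈ S) → p (x, y, z) = 0)
    {g g' : Vec d → Vec d → Vec d → ℝ}
    (h : ∀ x ∈ S, ∀ y ∈ S, ∀ z ∈ S, g x y z = g' x y z) :
    prodExpectation p g = prodExpectation p g' :=
  integral_congr_ae ((ae_prodMeasure_mem hp hpS).mono fun _ hw => h _ hw.1 _ hw.2.1 _ hw.2.2)

lemma empAverage_congr {n m k : ℕ} {I : Finset (Fin n)} {A : Vec d → Finset (Fin n)}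
    {x y z : Fin n → Vec d} {g g' : Vec d → Vec d → Vec d → ℝ}
    (h : ∀ x ∈ S, ∀ y ∈ S, ∀ z ∈ S, g x y z = g' x y z)
    (hS : ∀ i, x i ∈ S ∧ y i ∈ S ∧ z i ∈ S) :
    empAverage g m k I A x y z = empAverage g' m k I A x y z := by
  simp only [empAverage]
  congr 1
  refine Finset.sum_congr rfl fun i _ => ?_
  congr 1
  exact Finset.sum_congr rfl fun j _ => h _ (hS j).1 _ (hS i).2.1 _ (hS i).2.2

/-- Clamping to [-M, M] leaves `g` unchanged on S³, which carries both the data and the limiting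
measure, and supplies the global bound used in the estimates. -/
lemma exists_bounded_extension {g : Vec d → Vec d → Vec d → ℝ}
    (hg : Measurable fun w : Vec d × Vec d × Vec d => g w.1 w.2.1 w.2.2) {M : ℝ} (hM0 : 0 ≤ M)
    (hM : ∀ x ∈ S, ∀ y ∈ S, ∀ z ∈ S, |g x y z| ≤ M) :
    ∃ g' : Vec d → Vec d → Vec d → ℝ,
      (Measurable fun w : Vec d × Vec d × Vec d => g' w.1 w.2.1 w.2.2) ∧
      (∀ x y z, |g' x y z| ≤ M) ∧ ∀ x ∈ S, ∀ y ∈ S, ∀ z ∈ S, g x y z = g' x y z := by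
  refine ⟨fun x y z => max (-M) (min M (g x y z)),
    measurable_const.max (measurable_const.min hg), fun x y z => ?_, fun x hx y hy z hz => ?_⟩
  · exact abs_le.2 ⟨le_max_left _ _, max_le (by linarith) (min_le_left _ _)⟩
  · obtain ⟨h1, h2⟩ := abs_le.1 (hM x hx y hy z hz)
    exact ((max_eq_right (le_min (by linarith) h1)).trans (min_eq_right h2)).symm

end Support

/-! ### Conditioning on the random isolated set -/

section Sample

variable {Ω : Type*} [MeasurableSpace Ω] {P : Measure Ω} {d n m : ℕ}
  {p : Vec d × Vec d × Vec d → ℝ≥0∞} {X Y Z : Fin n → Ω → Vec d} {I : Ω → Finset (Fin n)}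

lemma IsSample.measurable_triple (h : IsSample P p m X Y Z I) (i : Fin n) :
    Measurable fun ω => (X i ω, Y i ω, Z i ω) :=
  (h.measurable_X i).prodMk ((h.measurable_Y i).prodMk (h.measurable_Z i))

variable [IsProbabilityMeasure P]

lemma IsSample.map_triples (h : IsSample P p m X Y Z I) :
    P.map (fun ω i => (X i ω, Y i ω, Z i ω)) = Measure.pi fun _ : Fin n => volume.withDensity p := by
  rw [(iIndepFun_iff_map_fun_eq_pi_map fun i => (h.measurable_triple i).aemeasurable).1 h.indep]
  simp_rw [h.law]

/-- A bound on the probability of data events, uniform in the isolated set, is inherited by the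
event for the random isolated set. -/
lemma IsSample.measure_le (h : IsSample P p m X Y Z I)
    (E : Finset (Fin n) → Set (Fin n → Vec d × Vec d × Vec d)) {B : ℝ≥0∞}
    (hE : ∀ s, s.card = m → (Measure.pi fun _ : Fin n => volume.withDensity p) (E s) ≤ B) :
    P {ω | (fun i => (X i ω, Y i ω, Z i ω)) ∈ E (I ω)} ≤ B := by
  set Q := Measure.pi fun _ : Fin n => volume.withDensity p with hQ
  have hW : Measurable fun ω i => (X i ω, Y i ω, Z i ω) :=
    measurable_pi_lambda _ h.measurable_triple
  -- Measurable hulls have the same measure and make independence applicable without measurability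
  -- of `E s`.
  have hsub : {ω | (fun i => (X i ω, Y i ω, Z i ω)) ∈ E (I ω)} ⊆
      ⋃ s ∈ Finset.powersetCard m Finset.univ,
        I ⁻¹' {s} ∩ (fun ω i => (X i ω, Y i ω, Z i ω)) ⁻¹' toMeasurable Q (E s) := by
    intro ω hω
    simp only [Set.mem_iUnion]
    exact ⟨I ω, Finset.mem_powersetCard_univ.2 (h.card_I ω), rfl, subset_toMeasurable _ _ hω⟩
  have hterm (s : Finset (Fin n)) (hs : s ∈ Finset.powersetCard m Finset.univ) :
      P (I ⁻¹' {s} ∩ (fun ω i => (X i ω, Y i ω, Z i ω)) ⁻¹' toMeasurable Q (E s)) ≤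
        ((n.choose m : ℕ) : ℝ≥0∞)⁻¹ * B := by
    have hsm := Finset.mem_powersetCard_univ.1 hs
    rw [h.indep_I.measure_inter_preimage_eq_mul _ _ MeasurableSpace.measurableSet_top
      (measurableSet_toMeasurable _ _), ← Measure.map_apply hW (measurableSet_toMeasurable _ _),
      h.map_triples, measure_toMeasurable]
    exact mul_le_mul' (h.uniform_I s hsm).le (hE s hsm)
  refine (measure_mono hsub).trans ((measure_biUnion_finset_le _ _).trans
    ((Finset.sum_le_card_nsmul _ _ _ hterm).trans ?_))
  -- There are `n.choose m` possible sets, each drawn with the inverse probability.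
  rw [Finset.card_powersetCard, Finset.card_univ, Fintype.card_fin, nsmul_eq_mul, ← mul_assoc]
  exact mul_le_of_le_one_left' (ENNReal.mul_inv_le_one _)

end Sample

/-- The other two terms of δ₁ are nonnegative; the first alone suffices. -/
lemma two_mul_exp_le_delta1 (n m k γ : ℕ) (ε c M : ℝ) :
    2 * Real.exp (-2 * ε ^ 2 * (k : ℝ) ^ 2 / ((n : ℝ) * c ^ 2)) ≤ delta1 n m k γ ε c M := by
  rw [delta1, add_assoc]
  exact le_add_of_nonneg_right (by positivity)

end IsolatedKNN

theorem theorem1 {d : ℕ} (hd : 0 < d)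
    -- the alphabet and the joint density of `(X, Y, Z)` on its cube
    (S : Set (Vec d)) (hS : MeasurableSet S)
    (p : Vec d × Vec d × Vec d → ℝ≥0∞) (hp : Measurable p) (hp1 : ∫⁻ w, p w = 1)
    (hpS : ∀ x y z, ¬ (x ∈ S ∧ y ∈ S ∧ z ∈ S) → p (x, y, z) = 0)
    -- the bounded function `g`
    (g : Vec d → Vec d → Vec d → ℝ)
    (hg : Measurable fun w : Vec d × Vec d × Vec d => g w.1 w.2.1 w.2.2)
    (gmin gmax : ℝ)
    (hgb : ∀ x ∈ S, ∀ y ∈ S, ∀ z ∈ S, gmin ≤ g x y z ∧ g x y z ≤ gmax)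
    -- the growth of `k` and `m`
    (k m : ℕ → ℕ) (ε₀ : ℝ) (hε₀ : 0 < ε₀)
    (hk : Asymptotics.IsTheta atTop (fun n : ℕ => (k n : ℝ))
      (fun n : ℕ => (n : ℝ) ^ (1 / 2 + ε₀ : ℝ)))
    (hkm : ∀ᶠ n in atTop, k n ≤ m n ∧ m n + k n ≤ n)
    (hknm : Tendsto (fun n : ℕ => (k n : ℝ) / ((n : ℝ) - (m n : ℝ))) atTop (𝓝 0))
    (ε : ℝ) (hε : 0 < ε) :
    ∃ n₀ : ℕ, ∀ n : ℕ, n₀ < n →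
      ∀ {Ω : Type*} [MeasurableSpace Ω] (P : Measure Ω) [IsProbabilityMeasure P]
        (X Y Z : Fin n → Ω → Vec d) (I : Ω → Finset (Fin n)),
        IsSample P p (m n) X Y Z I →
        -- `A ω ζ` is the set of the `k` nearest neighbours of `ζ` outside the isolated set
        ∀ A : Ω → Vec d → Finset (Fin n),
          (∀ ω ζ, IsKNearest (fun i => Z i ω) (I ω)ᶜ (k n) ζ (A ω ζ)) →
          P.real {ω | 3 * ε ≤ |empAverage g (m n) (k n) (I ω) (A ω)
              (fun i => X i ω) (fun i => Y i ω) (fun i => Z i ω) - prodExpectation p g|}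
            ≤ delta1 n (m n) (k n) (coneCover d) ε (gmax - gmin) (max |gmin| |gmax|) := by
  -- Here division by zero makes the exponent 0, so the bound is at least 2.
  by_cases hc : gmax - gmin = 0
  · refine ⟨0, fun n _ Ω _ P _ X Y Z I _ A _ => ?_⟩
    refine le_trans ?_ (two_mul_exp_le_delta1 _ _ _ _ _ _ _)
    rw [hc]
    refine measureReal_le_one.trans ?_
    norm_num
  -- The added 1 ensures `1 ≤ M`, as needed for the counts.
  set M : ℝ := max |gmin| |gmax| + 1 with hM
  have hM1 : 1 ≤ M := le_add_of_nonneg_left (le_max_of_le_left (abs_nonneg _))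
  have hgM : ∀ x ∈ S, ∀ y ∈ S, ∀ z ∈ S, |g x y z| ≤ M := fun x hx y hy z hz =>
    (abs_le_max_abs_abs (hgb x hx y hy z hz).1 (hgb x hx y hy z hz).2).trans (by linarith)
  obtain ⟨g', hg', hg'M, hgg'⟩ := exists_bounded_extension hg (by linarith) hgM
  have hν := isProbabilityMeasure_withDensity hp1
  have hμP := isProbabilityMeasure_withDensity_margZ hp hp1
  set μ := volume.withDensity (margZ p) with hμ
  have hac : μ ≪ volume := withDensity_absolutelyContinuous _ _
  have hνμ : (volume.withDensity p).map (fun w => w.2.2) = μ := map_withDensity_snd_snd hp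
  -- Chosen so that the deviation bound `(M + 2) * η` equals `ε`.
  set η := ε / (M + 2) with hη
  have hη0 : 0 < η := by positivity
  have hkpos := eventually_pos_of_isTheta hε₀ hk
  have ht0 : ∀ᶠ n : ℕ in atTop, 0 < (k n : ℝ) / ((n : ℝ) - (m n : ℝ)) := by
    filter_upwards [hkpos, hkm] with n h0 h1
    have h2 : (m n : ℝ) + k n ≤ n := by exact_mod_cast h1.2
    have h3 : (0 : ℝ) < k n := Nat.cast_pos.2 h0
    exact div_pos h3 (by linarith)
  have hlim := tendsto_integral_localMean hd hp hp1 hg' hg'M ht0 hknm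
  have htail := eventually_mul_exp_neg_le hε₀ hk hkm hknm (rate_pos hM1 hη0)
    (D := 2 * ε ^ 2 / (gmax - gmin) ^ 2) (by positivity)
  obtain ⟨n₀, hn₀⟩ := eventually_atTop.1 (hkpos.and (hkm.and ((hknm.eventually
    (gt_mem_nhds one_pos)).and ((Metric.tendsto_nhds.1 hlim ε hε).and htail))))
  refine ⟨n₀, fun n hn Ω _ P _ X Y Z I hsample A hA => ?_⟩
  obtain ⟨hk0, ⟨hkm', hmk⟩, ht1, hclose, htail'⟩ := hn₀ n hn.le
  have hcard {s : Finset (Fin n)} (hs : s.card = m n) : sᶜ.card = n - m n := by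
    rw [Finset.card_compl, Fintype.card_fin, hs]
  have hcast : ((n - m n : ℕ) : ℝ) = (n : ℝ) - m n := Nat.cast_sub (by omega)
  -- The growth hypothesis gives only `≤`; strictness, and with it `t < 1`, comes from `k/(n-m) →
  -- 0`.
  have hkN : k n < n - m n := by
    have h1 : (0 : ℝ) < (n - m n : ℕ) := Nat.cast_pos.2 (by omega)
    rw [← hcast, div_lt_one h1] at ht1
    exact_mod_cast ht1
  set t := (k n : ℝ) / ((n : ℝ) - (m n : ℝ)) with ht
  have hdev : P {ω | (fun i => (X i ω, Y i ω, Z i ω)) ∈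
      deviationSet (volume.withDensity p) μ t g' η (I ω) (k n)} ≤
      ENNReal.ofReal ((4 * n + 2) * Real.exp (-(rate M η * k n))) := by
    refine hsample.measure_le (fun s => deviationSet (volume.withDensity p) μ t g' η s (k n))
      fun s hs => ?_
    refine measure_deviationSet_le hd hac hνμ hg' hg'M hM1 hη0 hk0 (hs ▸ hkm') ?_ ?_
    · rwa [hcard hs]
    · rw [hcard hs, hcast]
  have hae : ∀ᵐ ω ∂P, ∀ i, X i ω ∈ S ∧ Y i ω ∈ S ∧ Z i ω ∈ S := by
    refine ae_all_iff.2 fun i => ?_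
    have h1 := ae_withDensity_mem hp hpS
    rw [← hsample.law i] at h1
    exact ae_of_ae_map (hsample.measurable_triple i).aemeasurable h1
  have hsub : ∀ᵐ ω ∂P, 3 * ε ≤ |empAverage g (m n) (k n) (I ω) (A ω)
      (fun i => X i ω) (fun i => Y i ω) (fun i => Z i ω) - prodExpectation p g| →
      (fun i => (X i ω, Y i ω, Z i ω)) ∈
        deviationSet (volume.withDensity p) μ t g' η (I ω) (k n) := by
    filter_upwards [hae] with ω hω hbig
    -- Off the deviation set the stochastic error is at most `ε` and the bias is below `ε`, so the
    -- total is below `2ε`, contradicting `3ε`.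
    by_contra hnot
    have hIc := hsample.card_I ω
    have h1 := abs_empAverage_sub_le hd hac hνμ hg'M hk0 (by omega)
      (by rwa [hcard hIc]) (by rw [hcard hIc, hcast]) hnot (A := A ω) fun i _ => hA ω (Z i ω)
    rw [hIc, hη, mul_div_cancel₀ _ (by positivity)] at h1
    rw [empAverage_congr hgg' hω, prodExpectation_congr hp hpS hgg'] at hbig
    rw [Real.dist_eq] at hclose
    have h2 := abs_sub_le (empAverage g' (m n) (k n) (I ω) (A ω) (fun i => X i ω)
      (fun i => Y i ω) fun i => Z i ω)
      (∫ b, localMean (volume.withDensity p) μ t g' b ∂volume.withDensity p)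
      (prodExpectation p g')
    linarith
  have hfinal := (measure_mono_ae hsub).trans hdev
  refine le_trans ?_ (two_mul_exp_le_delta1 _ _ _ _ _ _ _)
  refine (ENNReal.toReal_mono ENNReal.ofReal_ne_top hfinal).trans ?_
  rw [ENNReal.toReal_ofReal (by positivity)]
  refine htail'.trans_eq ?_
  congr 2
  field_simp
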